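/- Conventions. A partition $\lambda$ of $n$ is identified with its Young diagram in French convention (rows of lengths $\lambda_1\ge\lambda_2\ge\cdots$ from bottom to top). $\mathrm{SYT}(\lambda)$ is the set of bijective fillings of $\lambda$ with $1,\dots,n$ that increase along rows and up columns. The content of a cell is its column index minus its row index; the content reading word $w_T$ of a tableau $T$ lists its entries by increasing content, and from southwest to northeast along each diagonal of constant content. The descent signature $\sigma(T)\in\{\pm1\}^{n-1}$ has $\sigma(T)_i=+1$ if $i$ appears to the left of $i+1$ in $w_T$, and $-1$ otherwise. For $1<i<n$ the elementary dual equivalence $d_i$ fixes a word in which $i$ lies between $i-1$ and $i+1$; otherwise it interchanges $i$ with whichever of $i\pm1$ is further away from $i$. A signed, colored graph of type $(n,N)$ consists of a finite vertex set $V$, a signature function $\sigma:V\to\{\pm1\}^{N-1}$, and for each $1<i<n$ a set $E_i$ of unordered pairs of distinct vertices. Its connected components are those of $(V,E_2\cup\cdots\cup E_{n-1})$, with the induced signatures and edges. It is a dual equivalence graph of type $(n,N)$ if $n\le N$ and the following hold (for all colors $1<i,j<n$ and all indices for which the quantities mentioned are defined): 1. For $w\in V$, $\sigma(w)_{i-1}=-\sigma(w)_i$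 if and only if there is $x\in V$ with $\{w,x\}\in E_i$; such an $x$ is unique when it exists. 2. If $\{w,x\}\in E_i$, then $\sigma(w)_j=-\sigma(x)_j$ for $j=i-1,i$, and $\sigma(w)_h=\sigma(x)_h$ for $h<i-2$ and for $h>i+1$. 3. If $\{w,x\}\in E_i$, then $\sigma(w)_{i-2}=-\sigma(x)_{i-2}$ implies $\sigma(w)_{i-2}=-\sigma(w)_{i-1}$, and $\sigma(w)_{i+1}=-\sigma(x)_{i+1}$ implies $\sigma(w)_{i+1}=-\sigma(w)_i$. 4. For $2<i<n$, every connected component of $(V,E_{i-1}\cup E_i)$ is, as an edge-colored graph, one of: a single vertex; a path $a,b,c$ with $\{a,b\}$ colored $i-1$ and $\{b,c\}$ colored $i$; two vertices joined by both an $(i-1)$-edge and an $i$-edge. For $3<i<n$, every connected component of $(V,E_{i-2}\cup E_{i-1}\cup E_i)$ is, as an edge-colored graph, one of: a single vertex; a path on four vertices whose successive edges are colored $i-2,\ i-1,\ i$; a path on five vertices whose successive adjacent pairs carry the color sets $\{i-2,i-1\},\{i\},\{i-2\},\{i-1,i\}$; the graph on $u,v,w,x,y,z$ with $E_{i-2}=\{vw,xy\}$,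 $E_{i-1}=\{uv,yz\}$, $E_i=\{vx,wy\}$. 5. If $|i-j|\ge3$, $\{w,x\}\in E_i$ and $\{x,y\}\in E_j$, then there is $v\in V$ with $\{w,v\}\in E_j$ and $\{v,y\}\in E_i$. 6. Any two vertices of a connected component of $(V,E_2\cup\cdots\cup E_i)$ can be connected by a path in $E_2\cup\cdots\cup E_i$ crossing at most one $E_i$ edge. For a partition $\lambda$ of $n$, the standard dual equivalence graph $\mathcal G_\lambda$ is the signed, colored graph of type $(n,n)$ with vertex set $\mathrm{SYT}(\lambda)$, signature $T\mapsto\sigma(T)$, and $\{T,U\}\in E_i$ if and only if $T\ne U$ and $w_T,w_U$ differ by $d_i$. An isomorphism between two signed, colored graphs of the same type $(n,N)$ is a bijection on vertices that preserves signatures and maps $i$-edges to $i$-edges for every $1<i<n$. **Theorem.** Every connected component of a dual equivalence graph of type $(n,n)$ is isomorphic to $\mathcal G_\lambda$ for a unique partition $\lambda$ of $n$. -/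

import Mathlib

/-- A signed, colored graph of type `(n, N)` on the finite vertex set `V`: a signature
`σ(v) ∈ {±1}^(N-1)`, indexed by `1, …, N-1`, for every vertex `v`, and for each `1 < i < n` a
collection `E_i` of pairs of distinct vertices. -/
structure SignedColoredGraph (V : Type*) [Finite V] (n N : ℕ) where
  signature : V → Set.Ico 1 N → ℤˣ
  edges : Set.Ioo 1 n → SimpleGraph V

/-- A finite graph with `m` edge colors on the vertices `0, …, size - 1`. -/
structure ColoredPattern (m : ℕ) where
  size : ℕ
  edge : Fin m → SimpleGraph (Fin size)

/-- The connected component `C` of the union of the edge sets `H 0, …, H (m-1)` is isomorphic, as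
an edge-colored graph, to the pattern `P`. -/
def ColoredPattern.Matches {m : ℕ} (P : ColoredPattern m) {V : Type*} (H : Fin m → SimpleGraph V)
    (C : (⨆ s, H s).ConnectedComponent) : Prop :=
  ∃ f : C.supp ≃ Fin P.size, ∀ (s : Fin m) (u v : C.supp),
    (H s).Adj u v ↔ (P.edge s).Adj (f u) (f v)

/-- The allowed connected components for two consecutive colors `i-1, i` (in this order): a single
vertex, a path with edges colored `i-1, i`, and a double edge. -/
def twoColorPatterns : List (ColoredPattern 2) :=
  [ ⟨1, ![⊥, ⊥]⟩,
    ⟨3, ![.fromEdgeSet {s(0, 1)}, .fromEdgeSet {s(1, 2)}]⟩,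
    ⟨2, ![.fromEdgeSet {s(0, 1)}, .fromEdgeSet {s(0, 1)}]⟩ ]

/-- The allowed connected components for three consecutive colors `i-2, i-1, i` (in this order):
a single vertex; a path with edges colored `i-2, i-1, i`; a path on five vertices whose consecutive
edges are colored `{i-2, i-1}` (a double edge), `i`, `i-2`, `{i-1, i}` (a double edge); and a
four-cycle colored `i-2, i, i-2, i` with one `(i-1)`-colored pendant edge at each of two opposite
vertices (the cycle is `1, 2, 4, 3`, the pendant edges are `{0, 1}` and `{4, 5}`). -/
def threeColorPatterns : List (ColoredPattern 3) :=
  [ ⟨1, ![⊥, ⊥, ⊥]⟩,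
    ⟨4, ![.fromEdgeSet {s(0, 1)}, .fromEdgeSet {s(1, 2)}, .fromEdgeSet {s(2, 3)}]⟩,
    ⟨5, ![.fromEdgeSet {s(0, 1), s(2, 3)}, .fromEdgeSet {s(0, 1), s(3, 4)},
          .fromEdgeSet {s(1, 2), s(3, 4)}]⟩,
    ⟨6, ![.fromEdgeSet {s(1, 2), s(3, 4)}, .fromEdgeSet {s(0, 1), s(4, 5)},
          .fromEdgeSet {s(1, 3), s(2, 4)}]⟩ ]

namespace SignedColoredGraph

/-- The coordinate `σ(v)_i`. It is only ever used for `1 ≤ i < N`. -/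
def sign {V : Type*} [Finite V] {n N : ℕ} (G : SignedColoredGraph V n N) (v : V) (i : ℕ) : ℤˣ :=
  if h : i ∈ Set.Ico 1 N then G.signature v ⟨i, h⟩ else 1

/-- The edge set `E_i`; there are no `i`-edges unless `1 < i < n`. -/
def E {V : Type*} [Finite V] {n N : ℕ} (G : SignedColoredGraph V n N) (i : ℕ) : SimpleGraph V :=
  open Classical in if h : i ∈ Set.Ioo 1 n then G.edges ⟨i, h⟩ else ⊥

/-- The uncolored graph with edge set `E_2 ∪ ⋯ ∪ E_i`. -/
def upTo {V : Type*} [Finite V] {n N : ℕ} (G : SignedColoredGraph V n N) (i : ℕ) :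
    SimpleGraph V :=
  ⨆ j ∈ Set.Icc 2 i, G.E j

/-- The uncolored graph with edge set `E_2 ∪ ⋯ ∪ E_{n-1}`; its connected components are the
connected components of the signed, colored graph. -/
def underlying {V : Type*} [Finite V] {n N : ℕ} (G : SignedColoredGraph V n N) : SimpleGraph V :=
  G.upTo (n - 1)

/-- The axioms of a dual equivalence graph of type `(n, N)`. -/
structure IsDualEquivalenceGraph {V : Type*} [Finite V] {n N : ℕ}
    (G : SignedColoredGraph V n N) : Prop where
  le : n ≤ N
  ax1 : ∀ (w : V) (i : ℕ), 1 < i → i < n →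
    (G.sign w (i - 1) = -G.sign w i ↔ ∃ x, (G.E i).Adj w x)
  ax1_unique : ∀ (w x y : V) (i : ℕ), 1 < i → i < n →
    (G.E i).Adj w x → (G.E i).Adj w y → x = y
  ax2_neg : ∀ (w x : V) (i : ℕ), 1 < i → i < n → (G.E i).Adj w x →
    G.sign w (i - 1) = -G.sign x (i - 1) ∧ G.sign w i = -G.sign x i
  ax2_eq : ∀ (w x : V) (i : ℕ), 1 < i → i < n → (G.E i).Adj w x →
    ∀ h : ℕ, 1 ≤ h → h < N → (h + 2 < i ∨ i + 1 < h) → G.sign w h = G.sign x h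
  ax3_left : ∀ (w x : V) (i : ℕ), 2 < i → i < n → (G.E i).Adj w x →
    G.sign w (i - 2) = -G.sign x (i - 2) → G.sign w (i - 2) = -G.sign w (i - 1)
  ax3_right : ∀ (w x : V) (i : ℕ), 1 < i → i < n → i + 1 < N → (G.E i).Adj w x →
    G.sign w (i + 1) = -G.sign x (i + 1) → G.sign w (i + 1) = -G.sign w i
  ax4_two : ∀ i : ℕ, 2 < i → i < n →
    ∀ C : (⨆ s, (![G.E (i - 1), G.E i] : Fin 2 → SimpleGraph V) s).ConnectedComponent,
      ∃ P ∈ twoColorPatterns, P.Matches _ C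
  ax4_three : ∀ i : ℕ, 3 < i → i < n →
    ∀ C : (⨆ s, (![G.E (i - 2), G.E (i - 1), G.E i] :
        Fin 3 → SimpleGraph V) s).ConnectedComponent,
      ∃ P ∈ threeColorPatterns, P.Matches _ C
  ax5 : ∀ (w x y : V) (i j : ℕ), 1 < i → i < n → 1 < j → j < n → (i + 3 ≤ j ∨ j + 3 ≤ i) →
    (G.E i).Adj w x → (G.E j).Adj x y → ∃ v, (G.E j).Adj w v ∧ (G.E i).Adj v y
  /-- A path in `E_2 ∪ ⋯ ∪ E_i` crossing at most one `E_i` edge consists of a path in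
  `E_2 ∪ ⋯ ∪ E_{i-1}`, at most one `E_i` edge, and another path in `E_2 ∪ ⋯ ∪ E_{i-1}`. -/
  ax6 : ∀ i : ℕ, 1 < i → i < n → ∀ w x : V, (G.upTo i).Reachable w x →
    ∃ u v : V, (G.upTo (i - 1)).Reachable w u ∧ (u = v ∨ (G.E i).Adj u v) ∧
      (G.upTo (i - 1)).Reachable v x

/-- The signed, colored graph induced on a set of vertices. -/
def induce {V : Type*} [Finite V] {n N : ℕ} (G : SignedColoredGraph V n N) (s : Set V) :
    SignedColoredGraph s n N where
  signature v := G.signature v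
  edges i := (G.edges i).induce s

/-- A morphism of signed, colored graphs: it preserves signatures and `i`-edges. -/
def IsMorphism {V W : Type*} [Finite V] [Finite W] {n N : ℕ} (G : SignedColoredGraph V n N)
    (H : SignedColoredGraph W n N) (φ : V → W) : Prop :=
  (∀ (v : V) (i : ℕ), 1 ≤ i → i < N → G.sign v i = H.sign (φ v) i) ∧
    ∀ (u v : V) (i : ℕ), 1 < i → i < n → (G.E i).Adj u v → (H.E i).Adj (φ u) (φ v)

/-- Two signed, colored graphs (satisfying axiom 1) are isomorphic when there is a morphism between
them that is a bijection on vertices. -/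
def IsIsomorphic {V W : Type*} [Finite V] [Finite W] {n N : ℕ} (G : SignedColoredGraph V n N)
    (H : SignedColoredGraph W n N) : Prop :=
  ∃ φ : V → W, G.IsMorphism H φ ∧ Function.Bijective φ

end SignedColoredGraph

/-- The Young diagram of a partition: its rows are the parts in weakly decreasing order. A cell
`(r, c)` is the cell in row `r` and column `c`, both counted from `0`. -/
def Nat.Partition.toYoungDiagram {n : ℕ} (p : n.Partition) : YoungDiagram :=
  YoungDiagram.ofRowLens (p.parts.sort (· ≥ ·)) (p.parts.pairwise_sort (· ≥ ·)).sortedGE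

/-- A standard Young tableau: a semistandard tableau that is a bijection from its shape to
`{1, …, |μ|}`. -/
structure StandardYoungTableau (μ : YoungDiagram) extends SemistandardYoungTableau μ where
  bijOn : Set.BijOn (fun c : ℕ × ℕ => entry c.1 c.2) (μ.cells : Set (ℕ × ℕ)) (Set.Icc 1 μ.card)

instance (μ : YoungDiagram) : Finite (StandardYoungTableau μ) := by
  refine Finite.of_injective (β := μ.cells → Set.Icc 1 μ.card)
    (fun T c => ⟨T.entry c.1.1 c.1.2, T.bijOn.mapsTo c.2⟩) ?_
  rintro ⟨T, hT⟩ ⟨U, hU⟩ h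
  have : T = U := by
    ext r c
    by_cases hc : (r, c) ∈ μ.cells
    · exact congrArg Subtype.val (congrFun h ⟨(r, c), hc⟩)
    · rw [T.zeros hc, U.zeros hc]
  subst this
  rfl

/-- The content reading word of a tableau lists its entries in the order in which this key of their
cells increases: by content (column minus row), and along a diagonal from southwest to northeast in
the French convention, that is, by increasing row. -/
def readingKey (c : ℕ × ℕ) : ℤ ×ₗ ℕ :=
  toLex ((c.2 : ℤ) - (c.1 : ℤ), c.1)

namespace StandardYoungTableau

/-- The entry `a` appears to the left of the entry `b` in the content reading word of `T`. -/
def LeftOf {μ : YoungDiagram} (T : StandardYoungTableau μ) (a b : ℕ) : Prop :=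
  ∃ x ∈ μ, ∃ y ∈ μ, T.entry x.1 x.2 = a ∧ T.entry y.1 y.2 = b ∧ readingKey x < readingKey y

/-- The entry `b` lies between the entries `a` and `c` in the content reading word of `T`. -/
def Between {μ : YoungDiagram} (T : StandardYoungTableau μ) (a b c : ℕ) : Prop :=
  (T.LeftOf a b ∧ T.LeftOf b c) ∨ (T.LeftOf c b ∧ T.LeftOf b a)

open Classical in
/-- The descent signature of a standard tableau. -/
noncomputable def descentSign {μ : YoungDiagram} (T : StandardYoungTableau μ) (i : ℕ) : ℤˣ :=
  if T.LeftOf i (i + 1) then 1 else -1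

open Classical in
/-- The elementary dual equivalence `d_i` applied to the content reading word of `T`, written as a
filling of the shape of `T`. If `i` lies between `i-1` and `i+1`, nothing changes. Otherwise `i-1`
and `i+1` are on the same side of `i`, and `i` is interchanged with the one further away: with
`i+1` if `i-1` lies between `i` and `i+1`, and with `i-1` if not. -/
noncomputable def elemDual {μ : YoungDiagram} (T : StandardYoungTableau μ) (i : ℕ) : ℕ → ℕ → ℕ :=
  if T.Between (i - 1) i (i + 1) then T.entry
  else if T.Between i (i - 1) (i + 1) then fun r c => Equiv.swap i (i + 1) (T.entry r c)
  else fun r c => Equiv.swap i (i - 1) (T.entry r c)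

end StandardYoungTableau

/-- The standard dual equivalence graph `G_λ` of a partition `λ` of `n`: its vertices are the
standard tableaux of shape `λ`, signed by the descent signature, and two distinct tableaux are
joined by an `i`-edge when they differ by an elementary dual equivalence for `i-1, i, i+1`. -/
noncomputable def standardDEG {n : ℕ} (p : n.Partition) :
    SignedColoredGraph (StandardYoungTableau p.toYoungDiagram) n n where
  signature T i := T.descentSign i
  edges i := SimpleGraph.fromRel fun T U => U.entry = T.elemDual i

/-! Every vertex receives a canonical standard tableau, recorded as the word of cells `t 1, t 2, …`
occupied by its entries, so that the signature is the descent signature and every edge is an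
elementary dual equivalence. Here `dual i` moves the entries `i, i + 1, i + 2` and therefore belongs
to color `i + 1`. The labels are built one entry at a time (`exists_isLabelling`), with the
invariant that the `n`-entry labels are distinct on each component of `E_2 ∪ ⋯ ∪ E_{n-1}`.

To add the entry `n + 1` (`exists_succ`): on such a component the labels run through all tableaux of
one shape. The sign at `n` depends only on the cell of `n`, and axiom 3 makes it monotone in the
content of that cell. So an addable cell separates the two signs, and `n + 1` is put there on the
whole component. The hard point is that `n`-edges then become dual equivalences (`adj_succ`). Axioms
2 and 5 make the two ends agree on `1, …, n - 2`. If `n + 1` lies between `n - 1` and `n`, a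
parallel copy of the edge is doubled by an `(n - 1)`-edge, by the two-color patterns. If `n - 1`
lies in the middle, the three-color patterns show that the same corners separate `n` from `n + 1` at
both ends, which determines both cells. Axiom 6 then preserves the invariant.

Everything rests on one fact: two different addable cells have a corner strictly between them in
content (`exists_corner_btw`). It makes the tableaux of one shape connected (`IsTableau.connected`),
whence surjectivity onto `SYT(λ)`. It also makes a tableau recoverable from the descents along all
sequences of dual equivalences (`eq_of_ascent_iff`), whence the uniqueness of `λ`. -/

namespace DualEquivalence

open Relation

/-! ### Corners and addable cells of a diagram -/

/-- The content of a cell. -/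
def content (x : ℕ × ℕ) : ℤ := (x.2 : ℤ) - (x.1 : ℤ)

/-- The integer `b` lies strictly between `a` and `c`. -/
def Btw (a b c : ℤ) : Prop := (a < b ∧ b < c) ∨ (c < b ∧ b < a)

/-- A cell that can be added to the finite set of cells `S`. -/
def Addable (S : Finset (ℕ × ℕ)) (a : ℕ × ℕ) : Prop := a ∉ S ∧ ∀ x < a, x ∈ S

/-- A cell that can be removed from the finite set of cells `S`. -/
def Corner (S : Finset (ℕ × ℕ)) (k : ℕ × ℕ) : Prop := k ∈ S ∧ ∀ x ∈ S, k ≤ x → x = k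

theorem cell_le {x y : ℕ × ℕ} : x ≤ y ↔ x.1 ≤ y.1 ∧ x.2 ≤ y.2 := Iff.rfl

theorem cell_ext {x y : ℕ × ℕ} (h₁ : x.1 = y.1) (h₂ : x.2 = y.2) : x = y := Prod.ext h₁ h₂

theorem cell_lt {x y : ℕ × ℕ} : x < y ↔ x.1 ≤ y.1 ∧ x.2 ≤ y.2 ∧ (x.1 < y.1 ∨ x.2 < y.2) := by
  rw [Prod.lt_iff]
  omega

theorem exists_corner_ge {S : Finset (ℕ × ℕ)} {x : ℕ × ℕ} (hx : x ∈ S) :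
    ∃ k, Corner S k ∧ x ≤ k := by
  obtain ⟨k, hxk, hk⟩ := S.exists_le_maximal hx
  exact ⟨k, ⟨hk.1, fun y hy hky => le_antisymm (hk.2 hy hky) hky⟩, hxk⟩

theorem Addable.not_le {S : Finset (ℕ × ℕ)} (hS : IsLowerSet (S : Set (ℕ × ℕ))) {a x : ℕ × ℕ}
    (ha : Addable S a) (hx : x ∈ S) : ¬ a ≤ x :=
  fun h => ha.1 (hS h hx)

theorem Addable.not_lt {S : Finset (ℕ × ℕ)} {a b : ℕ × ℕ}
    (ha : Addable S a) (hb : Addable S b) : ¬ a < b :=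
  fun h => ha.1 (hb.2 _ h)

/-- The cell `a` lies northwest of `b`, so the cell in the row of `b` and the column of `a` is in
`S`. A corner weakly northeast of it must stay below the row of `a` and to the left of the column of
`b`. -/
theorem exists_corner_of_content_lt {S : Finset (ℕ × ℕ)} (hS : IsLowerSet (S : Set (ℕ × ℕ)))
    {a b : ℕ × ℕ} (ha : Addable S a) (hb : Addable S b) (hab : content a < content b) :
    ∃ k, Corner S k ∧ content a < content k ∧ content k < content b := by
  have h₁ := ha.not_lt hb
  have h₂ := hb.not_lt ha
  rw [cell_lt] at h₁ h₂
  unfold content at *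
  have h₃ : ((b.1, a.2) : ℕ × ℕ) ∈ S := hb.2 _ (by rw [cell_lt]; dsimp only; omega)
  obtain ⟨k, hk, hle⟩ := exists_corner_ge h₃
  have h₄ := ha.not_le hS hk.1
  have h₅ := hb.not_le hS hk.1
  rw [cell_le] at h₄ h₅ hle
  dsimp only at hle
  exact ⟨k, hk, by omega, by omega⟩

theorem exists_corner_btw {S : Finset (ℕ × ℕ)} (hS : IsLowerSet (S : Set (ℕ × ℕ)))
    {a b : ℕ × ℕ} (ha : Addable S a) (hb : Addable S b) (hab : a ≠ b) :
    ∃ k, Corner S k ∧ Btw (content a) (content k) (content b) := by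
  rcases lt_trichotomy (content a) (content b) with h | h | h
  · obtain ⟨k, hk, h₁⟩ := exists_corner_of_content_lt hS ha hb h
    exact ⟨k, hk, Or.inl h₁⟩
  · have h₁ := ha.not_lt hb
    have h₂ := hb.not_lt ha
    rw [cell_lt] at h₁ h₂
    unfold content at h
    exact absurd (cell_ext (by omega) (by omega)) hab
  · obtain ⟨k, hk, h₁⟩ := exists_corner_of_content_lt hS hb ha h
    exact ⟨k, hk, Or.inr h₁⟩

theorem Corner.not_lt {S : Finset (ℕ × ℕ)} {a b : ℕ × ℕ}
    (ha : Corner S a) (hb : Corner S b) : ¬ a < b :=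
  fun h => h.ne' (ha.2 _ hb.1 h.le)

theorem isLowerSet_erase {S : Finset (ℕ × ℕ)} (hS : IsLowerSet (S : Set (ℕ × ℕ))) {k : ℕ × ℕ}
    (hk : Corner S k) : IsLowerSet ((S.erase k : Finset (ℕ × ℕ)) : Set (ℕ × ℕ)) := by
  intro a b hba ha
  simp only [Finset.coe_erase, Set.mem_sdiff, Finset.mem_coe, Set.mem_singleton_iff] at ha ⊢
  refine ⟨hS hba ha.1, ?_⟩
  rintro rfl
  exact ha.2 (hk.2 _ ha.1 hba)

theorem Corner.addable_erase {S : Finset (ℕ × ℕ)} (hS : IsLowerSet (S : Set (ℕ × ℕ)))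
    {k : ℕ × ℕ} (hk : Corner S k) : Addable (S.erase k) k :=
  ⟨by simp, fun _ hx => Finset.mem_erase.2 ⟨hx.ne, hS hx.le hk.1⟩⟩

theorem Corner.erase {S : Finset (ℕ × ℕ)} {k l : ℕ × ℕ} (hk : Corner S k) (hkl : k ≠ l) :
    Corner (S.erase l) k :=
  ⟨Finset.mem_erase.2 ⟨hkl, hk.1⟩, fun _ hx => hk.2 _ (Finset.mem_of_mem_erase hx)⟩

/-- The first cell of a row which is not in the set of cells. -/
theorem exists_first_notMem (S : Finset (ℕ × ℕ)) (r : ℕ) :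
    ∃ c, (r, c) ∉ S ∧ ∀ c' < c, (r, c') ∈ S := by
  classical
  have h : ∃ c, (r, c) ∉ S := by
    obtain ⟨c, hc⟩ := Infinite.exists_notMem_finset (S.image Prod.snd)
    exact ⟨c, fun h => hc (Finset.mem_image.2 ⟨_, h, rfl⟩)⟩
  exact ⟨Nat.find h, Nat.find_spec h, fun c' hc' => not_not.1 (Nat.find_min h hc')⟩

/-- A property of corners that is inherited by the corners of smaller content is the property of
lying to the left of some addable cell. -/
theorem exists_addable_threshold {S : Finset (ℕ × ℕ)} (hS : IsLowerSet (S : Set (ℕ × ℕ)))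
    (f : ℕ × ℕ → Prop)
    (hf : ∀ k l, Corner S k → Corner S l → content k < content l → f l → f k) :
    ∃ a, Addable S a ∧ ∀ k, Corner S k → (f k ↔ content k < content a) := by
  classical
  have key : ∀ r c, (∀ r' < r, (r', c) ∈ S) → (∀ c' < c, (r, c') ∈ S) → (r, c) ∉ S →
      Addable S (r, c) := by
    refine fun r c h₁ h₂ h₃ => ⟨h₃, fun x hx => ?_⟩
    rw [cell_lt] at hx
    rcases hx.2.2 with h | h
    · exact hS (a := (x.1, c)) (cell_le.2 ⟨le_rfl, hx.2.1⟩) (h₁ _ h)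
    · exact hS (a := (r, x.2)) (cell_le.2 ⟨hx.1, le_rfl⟩) (h₂ _ h)
  -- If some corner fails `f`, take the one of least content: the addable cell in the next row up
  -- lies just to its left. If none fails, the end of the bottom row lies to the right of all
  -- corners.
  by_cases hne : (S.filter fun k => Corner S k ∧ ¬ f k).Nonempty
  · obtain ⟨k, hk, hmin⟩ := Finset.exists_min_image _ content hne
    simp only [Finset.mem_filter] at hk hmin
    obtain ⟨hkS, hkc, hkf⟩ := hk
    obtain ⟨c, hc, hc'⟩ := exists_first_notMem S (k.1 + 1)
    have hck : c ≤ k.2 := by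
      by_contra hlt
      have := congrArg Prod.fst (hkc.2 _ (hc' k.2 (by omega)) (cell_le.2 ⟨by simp, by simp⟩))
      simp at this
    refine ⟨(k.1 + 1, c), key _ _ (fun r' hr' => ?_) hc' hc, fun l hl => ⟨fun hfl => ?_, fun h => ?_⟩⟩
    · exact hS (cell_le.2 ⟨by dsimp only; omega, hck⟩) hkS
    · have hlk : content l < content k := by
        by_contra hle
        rcases (not_lt.1 hle).lt_or_eq with h | h
        · exact hkf (hf _ _ hkc hl h hfl)
        · have h₁ := hkc.not_lt hl
          have h₂ := hl.not_lt hkc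
          rw [cell_lt] at h₁ h₂
          unfold content at h
          exact hkf ((cell_ext (by omega) (by omega) : k = l) ▸ hfl)
      have h₁ := hl.not_lt hkc
      have h₂ := hkc.not_lt hl
      rw [cell_lt] at h₁ h₂
      unfold content at *
      have h₃ : ((k.1 + 1, l.2) : ℕ × ℕ) ∈ S :=
        hS (a := l) (cell_le.2 ⟨by dsimp only; omega, le_rfl⟩) hl.1
      have h₄ : l.2 < c := by
        by_contra hle
        exact hc (hS (a := (_, l.2)) (cell_le.2 ⟨le_rfl, by dsimp only; omega⟩) h₃)
      push_cast
      omega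
    · by_contra hfl
      have := hmin l ⟨hl.1, hl, hfl⟩
      unfold content at *
      push_cast at h
      omega
  · obtain ⟨c, hc, hc'⟩ := exists_first_notMem S 0
    refine ⟨(0, c), key _ _ (by simp) hc' hc, fun l hl => ⟨fun _ => ?_, fun _ => ?_⟩⟩
    · have h₃ : ((0, l.2) : ℕ × ℕ) ∈ S := hS (a := l) (cell_le.2 ⟨by simp, le_rfl⟩) hl.1
      have h₄ : l.2 < c := by
        by_contra hle
        exact hc (hS (a := (_, l.2)) (cell_le.2 ⟨le_rfl, by dsimp only; omega⟩) h₃)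
      unfold content
      push_cast
      omega
    · by_contra hfl
      exact hne ⟨l, Finset.mem_filter.2 ⟨hl.1, hl, hfl⟩⟩

/-! ### Standard tableaux as words of cells -/

/-- The words of cells that list the cells of a standard tableau with `m` entries by increasing
entry: `t k` is the cell of the entry `k`, for `1 ≤ k ≤ m`. -/
structure IsTableau (m : ℕ) (t : ℕ → ℕ × ℕ) : Prop where
  inj : ∀ i j, 1 ≤ i → i ≤ m → 1 ≤ j → j ≤ m → t i = t j → i = j
  low : ∀ i, 1 ≤ i → i ≤ m → ∀ x ≤ t i, ∃ j, 1 ≤ j ∧ j ≤ i ∧ t j = x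

/-- The set of cells of the entries `1, …, m`. -/
def shape (t : ℕ → ℕ × ℕ) (m : ℕ) : Finset (ℕ × ℕ) := (Finset.Icc 1 m).image t

theorem mem_shape {t : ℕ → ℕ × ℕ} {m : ℕ} {x : ℕ × ℕ} :
    x ∈ shape t m ↔ ∃ j, 1 ≤ j ∧ j ≤ m ∧ t j = x := by
  simp [shape, and_assoc]

theorem shape_congr {s t : ℕ → ℕ × ℕ} {m : ℕ} (h : ∀ k, 1 ≤ k → k ≤ m → s k = t k) :
    shape s m = shape t m :=
  Finset.image_congr fun k hk => h k (Finset.mem_Icc.1 hk).1 (Finset.mem_Icc.1 hk).2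

namespace IsTableau

variable {m : ℕ} {s t : ℕ → ℕ × ℕ}

theorem mono (h : IsTableau m t) {l : ℕ} (hl : l ≤ m) : IsTableau l t :=
  ⟨fun i j h₁ h₂ h₃ h₄ => h.inj i j h₁ (h₂.trans hl) h₃ (h₄.trans hl),
    fun i h₁ h₂ => h.low i h₁ (h₂.trans hl)⟩

theorem congr (h : IsTableau m s) (hst : ∀ k, 1 ≤ k → k ≤ m → s k = t k) : IsTableau m t :=
  ⟨fun i j h₁ h₂ h₃ h₄ e => h.inj i j h₁ h₂ h₃ h₄ (by rw [hst i h₁ h₂, hst j h₃ h₄, e]),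
    fun i h₁ h₂ x hx => by
      obtain ⟨j, h₃, h₄, h₅⟩ := h.low i h₁ h₂ x (by rwa [hst i h₁ h₂])
      exact ⟨j, h₃, h₄, by rw [← hst j h₃ (h₄.trans h₂), h₅]⟩⟩

theorem isLowerSet (h : IsTableau m t) : IsLowerSet (shape t m : Set (ℕ × ℕ)) := by
  intro a b hba ha
  rw [Finset.mem_coe, mem_shape] at *
  obtain ⟨j, h₁, h₂, rfl⟩ := ha
  obtain ⟨i, h₃, h₄, h₅⟩ := h.low j h₁ h₂ b hba
  exact ⟨i, h₃, h₄.trans h₂, h₅⟩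

theorem card_shape (h : IsTableau m t) : (shape t m).card = m := by
  rw [shape, Finset.card_image_of_injOn, Nat.card_Icc, Nat.add_sub_cancel]
  intro i hi j hj e
  simp only [Finset.coe_Icc, Set.mem_Icc] at hi hj
  exact h.inj i j hi.1 hi.2 hj.1 hj.2 e

theorem le_of_le (h : IsTableau m t) {i j : ℕ} (hi : 1 ≤ i) (hi' : i ≤ m) (hj : 1 ≤ j)
    (hj' : j ≤ m) (hij : t i ≤ t j) : i ≤ j := by
  obtain ⟨l, h₁, h₂, h₃⟩ := h.low j hj hj' _ hij
  rwa [← h.inj l i h₁ (h₂.trans hj') hi hi' h₃]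

theorem notMem_shape (h : IsTableau m t) {l i : ℕ} (h₁ : l < i) (h₂ : i ≤ m) :
    t i ∉ shape t l := by
  rw [mem_shape]
  rintro ⟨j, h₃, h₄, h₅⟩
  have := h.inj j i h₃ (by omega) (by omega) h₂ h₅
  omega

theorem addable (h : IsTableau (m + 1) t) : Addable (shape t m) (t (m + 1)) := by
  refine ⟨h.notMem_shape (Nat.lt_succ_self m) le_rfl, fun x hx => ?_⟩
  obtain ⟨j, h₁, h₂, rfl⟩ := h.low (m + 1) (by omega) le_rfl x hx.le
  refine mem_shape.2 ⟨j, h₁, ?_, rfl⟩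
  by_contra h₃
  rw [show j = m + 1 by omega] at hx
  exact lt_irrefl _ hx

theorem corner (h : IsTableau m t) (hm : 1 ≤ m) : Corner (shape t m) (t m) := by
  refine ⟨mem_shape.2 ⟨m, hm, le_rfl, rfl⟩, fun x hx hle => ?_⟩
  obtain ⟨j, h₁, h₂, rfl⟩ := mem_shape.1 hx
  have := h.le_of_le hm le_rfl h₁ h₂ hle
  rw [show j = m by omega]

theorem succ (h : IsTableau m t) (ha : Addable (shape t m) (t (m + 1))) :
    IsTableau (m + 1) t := by
  have key : ∀ i, 1 ≤ i → i ≤ m → t i ≠ t (m + 1) :=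
    fun i h₁ h₂ e => ha.1 (mem_shape.2 ⟨i, h₁, h₂, e⟩)
  refine ⟨fun i j h₁ h₂ h₃ h₄ e => ?_, fun i h₁ h₂ x hx => ?_⟩
  · rcases Nat.lt_or_eq_of_le h₂ with h₅ | rfl <;> rcases Nat.lt_or_eq_of_le h₄ with h₆ | rfl
    · exact h.inj i j h₁ (by omega) h₃ (by omega) e
    · exact absurd e (key i h₁ (by omega))
    · exact absurd e.symm (key j h₃ (by omega))
    · rfl
  · rcases Nat.lt_or_eq_of_le h₂ with h₅ | rfl
    · exact h.low i h₁ (by omega) x hx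
    · rcases hx.eq_or_lt with rfl | hx
      · exact ⟨m + 1, by omega, le_rfl, rfl⟩
      · obtain ⟨j, h₃, h₄, h₅⟩ := mem_shape.1 (ha.2 x hx)
        exact ⟨j, h₃, by omega, h₅⟩

theorem shape_erase (h : IsTableau (m + 1) t) : shape t m = (shape t (m + 1)).erase (t (m + 1)) := by
  ext x
  rw [Finset.mem_erase, mem_shape, mem_shape]
  constructor
  · rintro ⟨j, h₁, h₂, rfl⟩
    refine ⟨fun e => ?_, j, h₁, by omega, rfl⟩
    have := h.inj j (m + 1) h₁ (by omega) (by omega) le_rfl e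
    omega
  · rintro ⟨hne, j, h₁, h₂, rfl⟩
    refine ⟨j, h₁, ?_, rfl⟩
    by_contra h₃
    exact hne (by rw [show j = m + 1 by omega])

/-- If `i < j` were on one diagonal, the cells below and to the left of `t j` would hold two further
entries strictly between `i` and `j`, forcing `j ≥ i + 3`. -/
theorem content_ne_of_le (h : IsTableau m t) {i j : ℕ} (hi : 1 ≤ i) (hij : i < j) (hj : j ≤ m)
    (hji : j ≤ i + 2) : content (t i) ≠ content (t j) := by
  intro e
  unfold content at e
  have h₀ : ¬ t j ≤ t i := fun hle => by
    have := h.le_of_le (by omega) hj hi (by omega) hle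
    omega
  rw [cell_le] at h₀
  obtain ⟨p, hp₁, hp₂, hp⟩ := h.low j (by omega) hj ((t j).1 - 1, (t j).2)
    (cell_le.2 ⟨by simp, le_rfl⟩)
  obtain ⟨q, hq₁, hq₂, hq⟩ := h.low j (by omega) hj ((t j).1, (t j).2 - 1)
    (cell_le.2 ⟨le_rfl, by simp⟩)
  have e₁ := congrArg Prod.fst hp
  have e₂ := congrArg Prod.snd hp
  have e₃ := congrArg Prod.fst hq
  have e₄ := congrArg Prod.snd hq
  dsimp only at e₁ e₂ e₃ e₄
  have ip := h.le_of_le hi (by omega) hp₁ (by omega) (cell_le.2 ⟨by omega, by omega⟩)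
  have iq := h.le_of_le hi (by omega) hq₁ (by omega) (cell_le.2 ⟨by omega, by omega⟩)
  have n₁ : p ≠ i := by rintro rfl; omega
  have n₂ : q ≠ i := by rintro rfl; omega
  have n₃ : p ≠ j := by rintro rfl; omega
  have n₄ : q ≠ j := by rintro rfl; omega
  have n₅ : p ≠ q := by rintro rfl; omega
  omega

/-- If `t i ≤ t (i + 1)`, no other cell fits between the two, so they are adjacent and their
contents differ by one. -/
theorem not_le_of_content (h : IsTableau m t) {i : ℕ} (hi : 1 ≤ i) (hi' : i + 1 ≤ m)
    (hc : content (t i) + 2 ≤ content (t (i + 1)) ∨ content (t (i + 1)) + 2 ≤ content (t i)) :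
    ¬ t i ≤ t (i + 1) := by
  intro hle
  have key : ∀ y, t i ≤ y → y ≤ t (i + 1) → y ≠ t i → y = t (i + 1) := by
    intro y h₁ h₂ h₃
    obtain ⟨j, h₄, h₅, rfl⟩ := h.low (i + 1) (by omega) hi' y h₂
    have h₆ := h.le_of_le hi (by omega) h₄ (by omega) h₁
    have h₇ : j ≠ i := by rintro rfl; exact h₃ rfl
    rw [show j = i + 1 by omega]
  rw [cell_le] at hle
  unfold content at hc
  rcases hc with hc | hc
  · have := key ((t (i + 1)).1, (t (i + 1)).2 - 1)
      (cell_le.2 ⟨by dsimp only; omega, by dsimp only; omega⟩)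
      (cell_le.2 ⟨le_rfl, by dsimp only; omega⟩)
      (fun e => by have := congrArg Prod.snd e; dsimp only at this; omega)
    have := congrArg Prod.snd this
    dsimp only at this
    omega
  · have := key ((t (i + 1)).1 - 1, (t (i + 1)).2)
      (cell_le.2 ⟨by dsimp only; omega, by dsimp only; omega⟩)
      (cell_le.2 ⟨by dsimp only; omega, le_rfl⟩)
      (fun e => by have := congrArg Prod.fst e; dsimp only at this; omega)
    have := congrArg Prod.fst this
    dsimp only at this
    omega

theorem swap (h : IsTableau m t) {i : ℕ} (hi : 1 ≤ i) (hi' : i + 1 ≤ m)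
    (hc : ¬ t i ≤ t (i + 1)) : IsTableau m (t ∘ Equiv.swap i (i + 1)) := by
  have hs : ∀ j, Equiv.swap i (i + 1) j = if j = i then i + 1 else if j = i + 1 then i else j :=
    fun j => Equiv.swap_apply_def i (i + 1) j
  refine ⟨fun a b h₁ h₂ h₃ h₄ e => ?_, fun j h₁ h₂ x hx => ?_⟩
  · refine (Equiv.swap i (i + 1)).injective (h.inj _ _ ?_ ?_ ?_ ?_ e) <;> rw [hs] <;>
      split_ifs <;> omega
  · simp only [Function.comp_apply] at hx ⊢
    by_cases h₃ : j = i
    · subst h₃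
      rw [Equiv.swap_apply_left] at hx
      obtain ⟨l, h₄, h₅, rfl⟩ := h.low (j + 1) (by omega) hi' x hx
      have h₆ : l ≠ j := by rintro rfl; exact hc hx
      by_cases h₇ : l = j + 1
      · exact ⟨j, hi, le_rfl, by rw [Equiv.swap_apply_left, h₇]⟩
      · exact ⟨l, h₄, by omega, by rw [Equiv.swap_apply_of_ne_of_ne h₆ h₇]⟩
    by_cases h₃' : j = i + 1
    · subst h₃'
      rw [Equiv.swap_apply_right] at hx
      obtain ⟨l, h₄, h₅, rfl⟩ := h.low i hi (by omega) x hx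
      refine ⟨Equiv.swap i (i + 1) l, ?_, ?_, by rw [Equiv.swap_apply_self]⟩ <;> rw [hs] <;>
        split_ifs <;> omega
    · rw [Equiv.swap_apply_of_ne_of_ne h₃ h₃'] at hx
      obtain ⟨l, h₄, h₅, rfl⟩ := h.low j h₁ h₂ x hx
      refine ⟨Equiv.swap i (i + 1) l, ?_, ?_, by rw [Equiv.swap_apply_self]⟩ <;> rw [hs] <;>
        split_ifs <;> omega

end IsTableau

/-! ### Elementary dual equivalences of words -/

theorem Btw.symm {a b c : ℤ} (h : Btw a b c) : Btw c b a := Or.symm h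

open Classical in
/-- The elementary dual equivalence of the entries `i`, `i + 1` and `i + 2`. -/
noncomputable def dual (i : ℕ) (t : ℕ → ℕ × ℕ) : ℕ → ℕ × ℕ :=
  if Btw (content (t i)) (content (t (i + 1))) (content (t (i + 2))) then t
  else if Btw (content (t (i + 1))) (content (t i)) (content (t (i + 2))) then
    t ∘ Equiv.swap (i + 1) (i + 2)
  else t ∘ Equiv.swap i (i + 1)

theorem dual_of_btw {i : ℕ} {t : ℕ → ℕ × ℕ}
    (h : Btw (content (t i)) (content (t (i + 1))) (content (t (i + 2)))) : dual i t = t :=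
  if_pos h

theorem dual_of_btw_left {i : ℕ} {t : ℕ → ℕ × ℕ}
    (h : Btw (content (t (i + 1))) (content (t i)) (content (t (i + 2)))) :
    dual i t = t ∘ Equiv.swap (i + 1) (i + 2) := by
  rw [dual, if_neg, if_pos h]
  unfold Btw at *
  omega

theorem dual_of_btw_right {i : ℕ} {t : ℕ → ℕ × ℕ}
    (h : Btw (content (t i)) (content (t (i + 2))) (content (t (i + 1)))) :
    dual i t = t ∘ Equiv.swap i (i + 1) := by
  rw [dual, if_neg, if_neg]
  all_goals
    unfold Btw at *
    omega

theorem swap_of_gt {i k : ℕ} (h : k < i ∨ i + 1 < k) : Equiv.swap i (i + 1) k = k :=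
  Equiv.swap_apply_of_ne_of_ne (by omega) (by omega)

theorem dual_apply_of_gt {i k : ℕ} (t : ℕ → ℕ × ℕ) (h : k < i ∨ i + 2 < k) : dual i t k = t k := by
  unfold dual
  split_ifs
  · rfl
  · rw [Function.comp_apply, swap_of_gt (by omega)]
  · rw [Function.comp_apply, swap_of_gt (by omega)]

theorem dual_apply_congr {i : ℕ} {s t : ℕ → ℕ × ℕ} (h₀ : s i = t i) (h₁ : s (i + 1) = t (i + 1))
    (h₂ : s (i + 2) = t (i + 2)) {k : ℕ} (hk : s k = t k) : dual i s k = dual i t k := by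
  unfold dual
  rw [h₀, h₁, h₂]
  split_ifs
  · exact hk
  · by_cases e₁ : k = i + 1
    · subst e₁; simpa using h₂
    by_cases e₂ : k = i + 2
    · subst e₂; simpa using h₁
    simpa [Equiv.swap_apply_of_ne_of_ne e₁ e₂] using hk
  · by_cases e₁ : k = i
    · subst e₁; simpa using h₁
    by_cases e₂ : k = i + 1
    · subst e₂; simpa using h₀
    simpa [Equiv.swap_apply_of_ne_of_ne e₁ e₂] using hk

theorem dual_update {i m : ℕ} (t : ℕ → ℕ × ℕ) (a : ℕ × ℕ) (h : i + 2 < m) :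
    dual i (Function.update t m a) = Function.update (dual i t) m a := by
  funext k
  by_cases hk : k = m
  · subst hk
    rw [dual_apply_of_gt _ (Or.inr h), Function.update_self, Function.update_self]
  · rw [Function.update_of_ne hk]
    refine dual_apply_congr ?_ ?_ ?_ ?_ <;> rw [Function.update_of_ne] <;> omega

namespace IsTableau

variable {m : ℕ} {s t : ℕ → ℕ × ℕ}

theorem content_ne₁ (h : IsTableau m t) {i : ℕ} (hi : 1 ≤ i) (hi' : i + 1 ≤ m) :
    content (t i) ≠ content (t (i + 1)) :=
  h.content_ne_of_le hi (by omega) hi' (by omega)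

theorem content_ne₂ (h : IsTableau m t) {i : ℕ} (hi : 1 ≤ i) (hi' : i + 2 ≤ m) :
    content (t i) ≠ content (t (i + 2)) :=
  h.content_ne_of_le hi (by omega) hi' (by omega)

theorem btw_cases (h : IsTableau m t) {i : ℕ} (hi : 1 ≤ i) (hi' : i + 2 ≤ m) :
    Btw (content (t i)) (content (t (i + 1))) (content (t (i + 2))) ∨
    Btw (content (t (i + 1))) (content (t i)) (content (t (i + 2))) ∨
    Btw (content (t i)) (content (t (i + 2))) (content (t (i + 1))) := by
  have h₁ := h.content_ne₁ hi (by omega)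
  have h₂ := h.content_ne₁ (i := i + 1) (by omega) hi'
  have h₃ := h.content_ne₂ hi hi'
  rw [show i + 1 + 1 = i + 2 from rfl] at h₂
  unfold Btw
  omega

theorem not_le_of_btw (h : IsTableau m t) {i : ℕ} {b : ℤ} (hi : 1 ≤ i) (hi' : i + 1 ≤ m)
    (hb : Btw (content (t i)) b (content (t (i + 1)))) : ¬ t i ≤ t (i + 1) := by
  refine h.not_le_of_content hi hi' ?_
  unfold Btw at hb
  omega

theorem isTableau_dual (h : IsTableau m t) {i : ℕ} (hi : 1 ≤ i) (hi' : i + 2 ≤ m) :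
    IsTableau m (dual i t) := by
  rcases h.btw_cases hi hi' with hb | hb | hb
  · rwa [dual_of_btw hb]
  · rw [dual_of_btw_left hb]
    exact h.swap (by omega) hi' (h.not_le_of_btw (by omega) hi' hb)
  · rw [dual_of_btw_right hb]
    exact h.swap hi (by omega) (h.not_le_of_btw hi (by omega) hb)

theorem dual_dual (h : IsTableau m t) {i : ℕ} (hi : 1 ≤ i) (hi' : i + 2 ≤ m) :
    dual i (dual i t) = t := by
  rcases h.btw_cases hi hi' with hb | hb | hb
  · rw [dual_of_btw hb, dual_of_btw hb]
  · rw [dual_of_btw_left hb, dual_of_btw_left]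
    · ext k : 1
      simp
    · simpa [swap_of_gt (i := i + 1) (k := i) (by omega)] using hb.symm
  · rw [dual_of_btw_right hb, dual_of_btw_right]
    · ext k : 1
      simp
    · simpa [swap_of_gt (i := i) (k := i + 2) (by omega)] using hb.symm

/-- A content strictly between those of the last two entries makes their cells incomparable, so they
may be exchanged. -/
theorem addable_of_btw (h : IsTableau (m + 2) t) {b : ℤ}
    (hb : Btw (content (t (m + 1))) b (content (t (m + 2)))) :
    Addable (shape t m) (t (m + 2)) := by
  have h₁ := ((h.swap (by omega) le_rfl (h.not_le_of_btw (by omega) le_rfl hb)).mono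
    (Nat.le_succ (m + 1))).addable
  rw [Function.comp_apply, Equiv.swap_apply_left] at h₁
  rwa [shape_congr (t := t ∘ Equiv.swap (m + 1) (m + 1 + 1))]
  intro k _ hk
  rw [Function.comp_apply, swap_of_gt (by omega)]

/-- The word `g` prescribes the irrelevant values outside `1, …, m`, so that later comparisons can
be equalities of functions. -/
theorem exists_shape {S : Finset (ℕ × ℕ)} (hS : IsLowerSet (S : Set (ℕ × ℕ)))
    (g : ℕ → ℕ × ℕ) {m : ℕ} (hm : S.card = m) :
    ∃ t, IsTableau m t ∧ shape t m = S ∧ ∀ k, k = 0 ∨ m < k → t k = g k := by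
  induction m generalizing S g with
  | zero =>
    rw [Finset.card_eq_zero] at hm
    exact ⟨g, ⟨by omega, by omega⟩, by simp [shape, hm], fun _ _ => rfl⟩
  | succ m ih =>
    obtain ⟨x, hx⟩ := Finset.card_pos.1 (by omega : 0 < S.card)
    obtain ⟨k, hk, -⟩ := exists_corner_ge hx
    obtain ⟨t, ht, hts, htg⟩ := ih (isLowerSet_erase hS hk) (Function.update g (m + 1) k)
      (by rw [Finset.card_erase_of_mem hk.1, hm, Nat.add_sub_cancel])
    have hlast : t (m + 1) = k := by rw [htg _ (by omega), Function.update_self]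
    have ht' : IsTableau (m + 1) t := ht.succ (by rw [hts, hlast]; exact hk.addable_erase hS)
    refine ⟨t, ht', ?_, fun j hj => ?_⟩
    · have h₁ := ht'.shape_erase
      rw [hts, hlast] at h₁
      have h₂ := mem_shape.2 ⟨m + 1, by omega, le_rfl, hlast⟩
      rw [← Finset.insert_erase hk.1, h₁, Finset.insert_erase h₂]
    · rw [htg _ (by omega), Function.update_of_ne (by omega)]

theorem shape_succ {t : ℕ → ℕ × ℕ} {m : ℕ} : shape t (m + 1) = insert (t (m + 1)) (shape t m) := by
  ext x
  rw [Finset.mem_insert, mem_shape, mem_shape]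
  constructor
  · rintro ⟨j, h₁, h₂, rfl⟩
    by_cases h₃ : j = m + 1
    · exact Or.inl (by rw [h₃])
    · exact Or.inr ⟨j, h₁, by omega, rfl⟩
  · rintro (rfl | ⟨j, h₁, h₂, rfl⟩)
    · exact ⟨m + 1, by omega, le_rfl, rfl⟩
    · exact ⟨j, h₁, by omega, rfl⟩

theorem exists_last {S : Finset (ℕ × ℕ)} (hS : IsLowerSet (S : Set (ℕ × ℕ))) {k : ℕ × ℕ}
    (hk : Corner S k) (g : ℕ → ℕ × ℕ) {m : ℕ} (hm : S.card = m + 1) :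
    ∃ t, IsTableau (m + 1) t ∧ shape t (m + 1) = S ∧ t (m + 1) = k ∧
      ∀ k, k = 0 ∨ m + 1 < k → t k = g k := by
  obtain ⟨t, ht, hts, htg⟩ := exists_shape (isLowerSet_erase hS hk) (Function.update g (m + 1) k)
    (m := m) (by rw [Finset.card_erase_of_mem hk.1, hm, Nat.add_sub_cancel])
  have hlast : t (m + 1) = k := by rw [htg _ (by omega), Function.update_self]
  refine ⟨t, ht.succ (by rw [hts, hlast]; exact hk.addable_erase hS), ?_, hlast, fun j hj => ?_⟩
  · rw [shape_succ, hts, hlast, Finset.insert_erase hk.1]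
  · rw [htg _ (by omega), Function.update_of_ne (by omega)]

/-- Once both corners are removed they are addable to what remains, so some corner of the remainder
lies between them. It takes the entry preceding theirs. -/
theorem exists_last_three {S : Finset (ℕ × ℕ)} (hS : IsLowerSet (S : Set (ℕ × ℕ)))
    {k l : ℕ × ℕ} (hk : Corner S k) (hl : Corner S l) (hkl : k ≠ l) (g : ℕ → ℕ × ℕ) :
    ∃ f t, S.card = f + 3 ∧ IsTableau (f + 3) t ∧ shape t (f + 3) = S ∧ t (f + 3) = k ∧
      t (f + 2) = l ∧ Btw (content (t (f + 2))) (content (t (f + 1))) (content (t (f + 3))) ∧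
      ∀ k, k = 0 ∨ f + 3 < k → t k = g k := by
  have hS₁ := isLowerSet_erase hS hk
  have hS₂ := isLowerSet_erase hS hl
  have hl₁ := hl.erase hkl.symm
  have hk₂ := hk.erase hkl
  have hk₃ := hk₂.addable_erase hS₂
  rw [Finset.erase_right_comm] at hk₃
  obtain ⟨j, hj, hb⟩ := exists_corner_btw (isLowerSet_erase hS₁ hl₁) (hl₁.addable_erase hS₁) hk₃
    hkl.symm
  have hc₁ := Finset.card_erase_add_one hk.1
  have hc₂ := Finset.card_erase_add_one hl₁.1
  have hc₃ := Finset.card_erase_add_one hj.1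
  obtain ⟨t, ht, hts, htj, htg⟩ := exists_last (isLowerSet_erase hS₁ hl₁) hj
    (Function.update (Function.update g (S.card) k) (S.card - 1) l) hc₃.symm
  obtain ⟨f, hf⟩ : ∃ f, S.card = f + 3 := ⟨S.card - 3, by omega⟩
  rw [show (((S.erase k).erase l).erase j).card = f by omega] at *
  rw [hf] at htg
  have e₁ : t (f + 2) = l := by
    rw [htg _ (by omega), show f + 3 - 1 = f + 2 from rfl, Function.update_self]
  have e₂ : t (f + 3) = k := by
    rw [htg _ (by omega), Function.update_of_ne (by omega), Function.update_self]
  have s₁ : shape t (f + 2) = S.erase k := by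
    rw [shape_succ, hts, e₁, Finset.insert_erase hl₁.1]
  have s₂ : shape t (f + 3) = S := by
    rw [shape_succ, s₁, e₂, Finset.insert_erase hk.1]
  have t₁ : IsTableau (f + 2) t := ht.succ (by rw [hts, e₁]; exact hl₁.addable_erase hS₁)
  refine ⟨f, t, hf, t₁.succ (by rw [s₁, e₂]; exact hk.addable_erase hS), s₂, e₂, e₁,
    by rwa [e₁, e₂, htj], fun i hi => ?_⟩
  rw [htg _ (by omega), Function.update_of_ne (by omega), Function.update_of_ne (by omega)]

end IsTableau

/-! ### Connectedness under dual equivalence -/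

/-- Two words are related when they differ by an elementary dual equivalence of entries at
most `m`. -/
def Step (m : ℕ) (s t : ℕ → ℕ × ℕ) : Prop := ∃ i, 1 ≤ i ∧ i + 2 ≤ m ∧ t = dual i s

theorem Step.mono {m l : ℕ} (h : m ≤ l) {s t : ℕ → ℕ × ℕ} (hs : Step m s t) : Step l s t := by
  obtain ⟨i, h₁, h₂, h₃⟩ := hs
  exact ⟨i, h₁, h₂.trans h, h₃⟩

theorem Step.isTableau {m l : ℕ} (h : m ≤ l) {s t : ℕ → ℕ × ℕ} (hs : ReflTransGen (Step m) s t)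
    (hS : IsTableau l s) : IsTableau l t := by
  induction hs with
  | refl => exact hS
  | tail _ h₁ ih =>
    obtain ⟨i, h₁, h₂, rfl⟩ := h₁
    exact ih.isTableau_dual h₁ (h₂.trans h)

theorem Step.apply_of_gt {m : ℕ} {s t : ℕ → ℕ × ℕ} (hs : ReflTransGen (Step m) s t) {k : ℕ}
    (hk : k = 0 ∨ m < k) : t k = s k := by
  induction hs with
  | refl => rfl
  | tail _ h₁ ih =>
    obtain ⟨i, h₁, h₂, rfl⟩ := h₁
    rw [dual_apply_of_gt _ (by omega), ih]

theorem swap_mem_Icc {m i j : ℕ} (hi : 1 ≤ i) (hi' : i + 1 ≤ m) (hj : 1 ≤ j) (hj' : j ≤ m) :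
    1 ≤ Equiv.swap i (i + 1) j ∧ Equiv.swap i (i + 1) j ≤ m := by
  rw [Equiv.swap_apply_def]
  split_ifs <;> omega

theorem shape_swap (t : ℕ → ℕ × ℕ) {m i : ℕ} (hi : 1 ≤ i) (hi' : i + 1 ≤ m) :
    shape (t ∘ Equiv.swap i (i + 1)) m = shape t m := by
  ext x
  simp only [mem_shape, Function.comp_apply]
  constructor
  · rintro ⟨j, h₁, h₂, rfl⟩
    obtain ⟨h₃, h₄⟩ := swap_mem_Icc hi hi' h₁ h₂
    exact ⟨_, h₃, h₄, rfl⟩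
  · rintro ⟨j, h₁, h₂, rfl⟩
    obtain ⟨h₃, h₄⟩ := swap_mem_Icc hi hi' h₁ h₂
    exact ⟨_, h₃, h₄, by rw [Equiv.swap_apply_self]⟩

theorem Step.shape_eq {m l : ℕ} (h : m ≤ l) {s t : ℕ → ℕ × ℕ}
    (hs : ReflTransGen (Step m) s t) : shape t l = shape s l := by
  induction hs with
  | refl => rfl
  | tail _ h₁ ih =>
    obtain ⟨i, h₁, h₂, rfl⟩ := h₁
    rw [← ih]
    unfold dual
    split_ifs
    · rfl
    · exact shape_swap _ (by omega) (by omega)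
    · exact shape_swap _ (by omega) (by omega)

/-- Tableaux of the same shape are dual equivalent. -/
theorem IsTableau.connected {m : ℕ} {s t : ℕ → ℕ × ℕ} (hs : IsTableau m s) (ht : IsTableau m t)
    (hst : shape s m = shape t m) (h : ∀ k, k = 0 ∨ m < k → s k = t k) :
    ReflTransGen (Step m) s t := by
  induction m generalizing s t with
  | zero =>
    have : s = t := funext fun k => h k (by omega)
    rw [this]
  | succ m ih =>
    have key : ∀ {s t : ℕ → ℕ × ℕ}, IsTableau (m + 1) s → IsTableau (m + 1) t →
        shape s (m + 1) = shape t (m + 1) → (∀ k, k = 0 ∨ m + 1 < k → s k = t k) →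
        s (m + 1) = t (m + 1) → ReflTransGen (Step (m + 1)) s t := by
      intro s t hs ht hst h hlast
      refine ReflTransGen.mono (fun _ _ => Step.mono (Nat.le_succ m)) _ _
        (ih (hs.mono (Nat.le_succ m)) (ht.mono (Nat.le_succ m)) ?_ fun k hk => ?_)
      · rw [hs.shape_erase, ht.shape_erase, hst, hlast]
      · by_cases hk' : k = m + 1
        · rw [hk', hlast]
        · exact h k (by omega)
    by_cases hlast : s (m + 1) = t (m + 1)
    · exact key hs ht hst h hlast
    -- Pass through a tableau `u` with last entry where `s` has it, the one before where `t` has its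
    -- last entry, and the third last in between. One dual equivalence exchanges the last two.
    · obtain ⟨f, u, hf, hu, hus, hu₃, hu₂, hub, hug⟩ := exists_last_three hs.isLowerSet
        (hs.corner (by omega)) (hst ▸ ht.corner (by omega)) hlast s
      rw [hs.card_shape] at hf
      obtain rfl : m = f + 2 := by omega
      have hd : dual (f + 1) u = u ∘ Equiv.swap (f + 2) (f + 3) := dual_of_btw_left hub
      have h₁ : ReflTransGen (Step (f + 3)) s u :=
        key hs hu hus.symm (fun k hk => (hug k hk).symm) hu₃.symm
      have h₂ : ReflTransGen (Step (f + 3)) s (dual (f + 1) u) :=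
        h₁.tail ⟨f + 1, by omega, le_rfl, rfl⟩
      refine h₂.trans (key (Step.isTableau le_rfl h₂ hs) ht ?_ (fun k hk => ?_) ?_)
      · rw [Step.shape_eq le_rfl h₂, hst]
      · rw [Step.apply_of_gt h₂ hk, h k hk]
      · rw [hd, Function.comp_apply, Equiv.swap_apply_right, hu₂]

/-- Any corner can be made the position of the last entry. -/
theorem IsTableau.exists_path_last {m : ℕ} {s : ℕ → ℕ × ℕ} (hs : IsTableau m s) {k : ℕ × ℕ}
    (hk : Corner (shape s m) k) : 1 ≤ m ∧ ∃ t, ReflTransGen (Step m) s t ∧ t m = k := by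
  have hc := Finset.card_pos.2 ⟨k, hk.1⟩
  rw [hs.card_shape] at hc
  obtain ⟨l, rfl⟩ : ∃ l, m = l + 1 := ⟨m - 1, by omega⟩
  obtain ⟨t, ht, hts, htk, htg⟩ := exists_last hs.isLowerSet hk s hs.card_shape
  exact ⟨hc, t, hs.connected ht hts.symm fun k hk => (htg k hk).symm, htk⟩

/-- Any corner different from the position of the last entry can be made the position of the last
entry but one, with the entry before it in between. -/
theorem IsTableau.exists_path_last_two {m : ℕ} {s : ℕ → ℕ × ℕ} (hs : IsTableau m s) {k : ℕ × ℕ}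
    (hk : Corner (shape s m) k) (hne : k ≠ s m) :
    ∃ f t, m = f + 3 ∧ ReflTransGen (Step (f + 2)) s t ∧ t (f + 2) = k ∧
      Btw (content (t (f + 2))) (content (t (f + 1))) (content (t (f + 3))) := by
  have hc := Finset.card_pos.2 ⟨k, hk.1⟩
  rw [hs.card_shape] at hc
  obtain ⟨f, t, hf, ht, hts, ht₃, ht₂, htb, htg⟩ := exists_last_three hs.isLowerSet
    (hs.corner (by omega)) hk hne.symm s
  rw [hs.card_shape] at hf
  subst hf
  refine ⟨f, t, rfl, ?_, ht₂, htb⟩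
  refine (hs.mono (Nat.le_succ _)).connected (ht.mono (Nat.le_succ _)) ?_ fun k hk => ?_
  · rw [hs.shape_erase, ht.shape_erase, hts, ht₃]
  · by_cases hk' : k = f + 3
    · rw [hk', ht₃]
    · rw [htg k (by omega)]

/-! ### Descents determine a tableau -/

/-- The entry `i` lies to the left of the entry `i + 1` in the content reading word. -/
def Ascent (t : ℕ → ℕ × ℕ) (i : ℕ) : Prop := content (t i) < content (t (i + 1))

theorem dual_congr_steps {m : ℕ} {R : (ℕ → ℕ × ℕ) → (ℕ → ℕ × ℕ) → Prop}
    (hR : ∀ s t i, R s t → 1 ≤ i → i + 2 ≤ m → R (dual i s) (dual i t)) {s t s' : ℕ → ℕ × ℕ}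
    (hst : R s t) (h : ∀ k, 1 ≤ k → k ≤ m → s k = t k) (hs : ReflTransGen (Step m) s s') :
    ∃ t', ReflTransGen (Step m) t t' ∧ R s' t' ∧ ∀ k, 1 ≤ k → k ≤ m → s' k = t' k := by
  induction hs with
  | refl => exact ⟨t, .refl, hst, h⟩
  | tail _ h₁ ih =>
    obtain ⟨i, h₁, h₂, rfl⟩ := h₁
    obtain ⟨t', h₃, h₄, h₅⟩ := ih
    exact ⟨dual i t', h₃.tail ⟨i, h₁, h₂, rfl⟩, hR _ _ i h₄ h₁ h₂, fun k hk hk' =>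
      dual_apply_congr (h₅ _ h₁ (by omega)) (h₅ _ (by omega) (by omega)) (h₅ _ (by omega) h₂)
        (h₅ k hk hk')⟩

/-- Tableaux whose descents agree along all sequences of elementary dual equivalences are equal. -/
theorem eq_of_ascent_iff {m : ℕ} {R : (ℕ → ℕ × ℕ) → (ℕ → ℕ × ℕ) → Prop}
    (hR : ∀ s t i, R s t → 1 ≤ i → i + 2 ≤ m → R (dual i s) (dual i t))
    (hT : ∀ s t, R s t → IsTableau m s ∧ IsTableau m t)
    (hA : ∀ s t i, R s t → 1 ≤ i → i + 1 ≤ m → (Ascent s i ↔ Ascent t i))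
    {s t : ℕ → ℕ × ℕ} (hst : R s t) : ∀ k, 1 ≤ k → k ≤ m → s k = t k := by
  induction m generalizing s t with
  | zero => omega
  | succ m ih =>
    have hR' : ∀ s t i, R s t → 1 ≤ i → i + 2 ≤ m → R (dual i s) (dual i t) :=
      fun s t i h h₁ h₂ => hR s t i h h₁ (by omega)
    have ih' : ∀ {s t}, R s t → ∀ k, 1 ≤ k → k ≤ m → s k = t k :=
      fun {s t} h => ih hR'
        (fun s t h => ⟨(hT s t h).1.mono (Nat.le_succ m), (hT s t h).2.mono (Nat.le_succ m)⟩)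
        (fun s t i h h₁ h₂ => hA s t i h h₁ (by omega)) h
    intro k hk hk'
    rcases Nat.lt_or_eq_of_le hk' with h | rfl
    · exact ih' hst k hk (by omega)
    by_contra hne
    obtain ⟨hs, ht⟩ := hT s t hst
    have ha := hs.addable
    have hb := ht.addable
    rw [← shape_congr (ih' hst)] at hb
    have hs' := hs.mono (Nat.le_succ m)
    -- Moving the entry `m` to a corner between the two candidate cells of `m + 1`, by the same
    -- steps in both words, makes the descents at `m` differ.
    obtain ⟨c, hc, hbtw⟩ := exists_corner_btw hs'.isLowerSet ha hb hne
    obtain ⟨hm, s', hss', hlast⟩ := hs'.exists_path_last hc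
    obtain ⟨t', htt', hst', heq⟩ := dual_congr_steps hR' hst (ih' hst) hss'
    have h₁ := hA s' t' m hst' hm le_rfl
    unfold Ascent at h₁
    rw [← heq m hm le_rfl, hlast, Step.apply_of_gt hss' (by omega),
      Step.apply_of_gt htt' (by omega)] at h₁
    unfold Btw at hbtw
    omega

/-! ### Consequences of the local patterns of axiom 4 -/

section Patterns

/-- A total map replaces the bijection of subtypes, so that questions on a component become
decidable statements about a finite pattern. -/
theorem _root_.ColoredPattern.Matches.exists_map {m : ℕ} {P : ColoredPattern m} {V : Type*}
    {H : Fin m → SimpleGraph V} {C : (⨆ s, H s).ConnectedComponent} (h : P.Matches H C) :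
    ∃ g : V → Fin P.size,
      (∀ s u v, u ∈ C.supp → (H s).Adj u v → (P.edge s).Adj (g u) (g v)) ∧
      (∀ u v, u ∈ C.supp → v ∈ C.supp → g u = g v → u = v) ∧
      (∀ s u q, u ∈ C.supp → (P.edge s).Adj (g u) q → ∃ v, (H s).Adj u v ∧ g v = q) := by
  classical
  obtain ⟨e, he⟩ := h
  obtain ⟨v₀, hv₀⟩ := C.nonempty_supp
  have hg : ∀ u (hu : u ∈ C.supp),
      (if hu : u ∈ C.supp then e ⟨u, hu⟩ else e ⟨v₀, hv₀⟩) = e ⟨u, hu⟩ := fun u hu => dif_pos hu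
  refine ⟨fun u => if hu : u ∈ C.supp then e ⟨u, hu⟩ else e ⟨v₀, hv₀⟩, ?_, ?_, ?_⟩
  · intro s u v hu huv
    have hv : v ∈ C.supp := (C.mem_supp_congr_adj ((SimpleGraph.iSup_adj).2 ⟨s, huv⟩)).1 hu
    dsimp only
    rw [hg u hu, hg v hv]
    exact (he s ⟨u, hu⟩ ⟨v, hv⟩).1 huv
  · intro u v hu hv huv
    dsimp only at huv
    rw [hg u hu, hg v hv] at huv
    exact congrArg Subtype.val (e.injective huv)
  · intro s u q hu huq
    dsimp only at huq ⊢
    rw [hg u hu] at huq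
    refine ⟨e.symm q, ?_, ?_⟩
    · rw [← e.apply_symm_apply q] at huq
      exact (he s ⟨u, hu⟩ (e.symm q)).2 huq
    · rw [hg _ (e.symm q).2]
      exact e.apply_symm_apply q

/-- A walk colored `1, 0, 1` fits only into the double edge. The same holds for `0, 1, 0` in the
next statement. -/
theorem twoColorPatterns_eq : ∀ P ∈ twoColorPatterns, ∀ w x y z : Fin P.size,
    (P.edge 0).Adj w y → (P.edge 1).Adj w x → (P.edge 1).Adj y z → y = x := by
  simp only [twoColorPatterns, List.forall_mem_cons, SimpleGraph.fromEdgeSet_adj,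
    Matrix.cons_val_zero, Matrix.cons_val_one, Set.mem_singleton_iff]
  refine ⟨?_, ?_, ?_, by simp⟩
  · simp
  · decide
  · decide

theorem twoColorPatterns_eq' : ∀ P ∈ twoColorPatterns, ∀ w x y z : Fin P.size,
    (P.edge 1).Adj w x → (P.edge 0).Adj w y → (P.edge 0).Adj x z → y = x := by
  simp only [twoColorPatterns, List.forall_mem_cons, SimpleGraph.fromEdgeSet_adj,
    Matrix.cons_val_zero, Matrix.cons_val_one, Set.mem_singleton_iff]
  refine ⟨?_, ?_, ?_, by simp⟩
  · simp
  · decide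
  · decide

theorem twoColorPatterns_exists : ∀ P ∈ twoColorPatterns, ∀ w x : Fin P.size,
    (P.edge 1).Adj w x → (∃ y, (P.edge 0).Adj w y) ∨ ∃ z, (P.edge 0).Adj x z := by
  simp only [twoColorPatterns, List.forall_mem_cons, SimpleGraph.fromEdgeSet_adj,
    Matrix.cons_val_zero, Matrix.cons_val_one, Set.mem_singleton_iff]
  refine ⟨?_, ?_, ?_, by simp⟩
  · simp
  · decide
  · decide

/-- A walk colored `2, 0, 2` occurs only in the five-vertex path, where a `1`-edge doubles one of
its `2`-edges, and in the six-vertex graph, where it closes up to the four-cycle. -/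
theorem threeColorPatterns_adj : ∀ P ∈ threeColorPatterns, ∀ w x y z : Fin P.size,
    (P.edge 2).Adj w x → (P.edge 0).Adj w y → (P.edge 2).Adj y z →
      (P.edge 0).Adj x z ∨ (P.edge 1).Adj w x ∨ (P.edge 1).Adj y z := by
  simp only [threeColorPatterns, List.forall_mem_cons, SimpleGraph.fromEdgeSet_adj,
    Matrix.cons_val_zero, Matrix.cons_val_one, Matrix.cons_val, Set.mem_singleton_iff,
    Set.mem_insert_iff]
  refine ⟨?_, ?_, ?_, ?_, by simp⟩
  · simp
  · decide
  · decide
  · decide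

variable {V : Type*} {A B D : SimpleGraph V}

theorem eq_of_twoColorPatterns
    (h : ∀ C : (⨆ s, (![A, B] : Fin 2 → SimpleGraph V) s).ConnectedComponent,
      ∃ P ∈ twoColorPatterns, P.Matches _ C) {w x y z : V} (h₁ : A.Adj w y) (h₂ : B.Adj w x)
    (h₃ : B.Adj y z) : y = x := by
  obtain ⟨P, hP, hm⟩ := h (SimpleGraph.connectedComponentMk _ w)
  obtain ⟨g, hg, hinj, -⟩ := hm.exists_map
  have hw : w ∈ ((⨆ s, (![A, B] : Fin 2 → SimpleGraph V) s).connectedComponentMk w).supp := rfl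
  have hy := (SimpleGraph.ConnectedComponent.mem_supp_congr_adj _
    ((SimpleGraph.iSup_adj).2 ⟨(0 : Fin 2), h₁⟩)).1 hw
  have hx := (SimpleGraph.ConnectedComponent.mem_supp_congr_adj _
    ((SimpleGraph.iSup_adj).2 ⟨(1 : Fin 2), h₂⟩)).1 hw
  exact hinj _ _ hy hx (twoColorPatterns_eq P hP _ _ _ _ (hg 0 _ _ hw h₁) (hg 1 _ _ hw h₂)
    (hg 1 _ _ hy h₃))

theorem eq_of_twoColorPatterns'
    (h : ∀ C : (⨆ s, (![A, B] : Fin 2 → SimpleGraph V) s).ConnectedComponent,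
      ∃ P ∈ twoColorPatterns, P.Matches _ C) {w x y z : V} (h₁ : B.Adj w x) (h₂ : A.Adj w y)
    (h₃ : A.Adj x z) : y = x := by
  obtain ⟨P, hP, hm⟩ := h (SimpleGraph.connectedComponentMk _ w)
  obtain ⟨g, hg, hinj, -⟩ := hm.exists_map
  have hw : w ∈ ((⨆ s, (![A, B] : Fin 2 → SimpleGraph V) s).connectedComponentMk w).supp := rfl
  have hx := (SimpleGraph.ConnectedComponent.mem_supp_congr_adj _
    ((SimpleGraph.iSup_adj).2 ⟨(1 : Fin 2), h₁⟩)).1 hw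
  have hy := (SimpleGraph.ConnectedComponent.mem_supp_congr_adj _
    ((SimpleGraph.iSup_adj).2 ⟨(0 : Fin 2), h₂⟩)).1 hw
  exact hinj _ _ hy hx (twoColorPatterns_eq' P hP _ _ _ _ (hg 1 _ _ hw h₁) (hg 0 _ _ hw h₂)
    (hg 0 _ _ hx h₃))

theorem exists_of_twoColorPatterns
    (h : ∀ C : (⨆ s, (![A, B] : Fin 2 → SimpleGraph V) s).ConnectedComponent,
      ∃ P ∈ twoColorPatterns, P.Matches _ C) {w x : V} (h₁ : B.Adj w x) :
    (∃ y, A.Adj w y) ∨ ∃ z, A.Adj x z := by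
  obtain ⟨P, hP, hm⟩ := h (SimpleGraph.connectedComponentMk _ w)
  obtain ⟨g, hg, -, hex⟩ := hm.exists_map
  have hw : w ∈ ((⨆ s, (![A, B] : Fin 2 → SimpleGraph V) s).connectedComponentMk w).supp := rfl
  have hx := (SimpleGraph.ConnectedComponent.mem_supp_congr_adj _
    ((SimpleGraph.iSup_adj).2 ⟨(1 : Fin 2), h₁⟩)).1 hw
  rcases twoColorPatterns_exists P hP _ _ (hg 1 _ _ hw h₁) with ⟨q, hq⟩ | ⟨q, hq⟩
  · obtain ⟨y, hy, -⟩ := hex 0 _ _ hw hq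
    exact Or.inl ⟨y, hy⟩
  · obtain ⟨z, hz, -⟩ := hex 0 _ _ hx hq
    exact Or.inr ⟨z, hz⟩

theorem adj_of_threeColorPatterns
    (h : ∀ C : (⨆ s, (![A, B, D] : Fin 3 → SimpleGraph V) s).ConnectedComponent,
      ∃ P ∈ threeColorPatterns, P.Matches _ C) {w x y z : V} (h₁ : D.Adj w x) (h₂ : A.Adj w y)
    (h₃ : D.Adj y z) : A.Adj x z ∨ B.Adj w x ∨ B.Adj y z := by
  obtain ⟨P, hP, hm⟩ := h (SimpleGraph.connectedComponentMk _ w)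
  obtain ⟨g, hg, hinj, hex⟩ := hm.exists_map
  have hw : w ∈ ((⨆ s, (![A, B, D] : Fin 3 → SimpleGraph V) s).connectedComponentMk w).supp := rfl
  have step : ∀ s u v, u ∈ ((⨆ s, (![A, B, D] : Fin 3 → SimpleGraph V) s).connectedComponentMk
      w).supp → ((![A, B, D] : Fin 3 → SimpleGraph V) s).Adj u v → v ∈
      ((⨆ s, (![A, B, D] : Fin 3 → SimpleGraph V) s).connectedComponentMk w).supp :=
    fun s u v hu huv => (SimpleGraph.ConnectedComponent.mem_supp_congr_adj _
      ((SimpleGraph.iSup_adj).2 ⟨s, huv⟩)).1 hu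
  have hx := step 2 _ _ hw h₁
  have hy := step 0 _ _ hw h₂
  have hz := step 2 _ _ hy h₃
  have key : ∀ s u v, u ∈ ((⨆ s, (![A, B, D] : Fin 3 → SimpleGraph V) s).connectedComponentMk
      w).supp → v ∈ ((⨆ s, (![A, B, D] : Fin 3 → SimpleGraph V) s).connectedComponentMk
      w).supp → (P.edge s).Adj (g u) (g v) → ((![A, B, D] : Fin 3 → SimpleGraph V) s).Adj u v := by
    intro s u v hu hv huv
    obtain ⟨v', h₁, h₂⟩ := hex s u _ hu huv
    rwa [hinj v' v (step s _ _ hu h₁) hv h₂] at h₁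
  rcases threeColorPatterns_adj P hP _ _ _ _ (hg 2 _ _ hw h₁) (hg 0 _ _ hw h₂)
    (hg 2 _ _ hy h₃) with h | h | h
  · exact Or.inl (key 0 _ _ hx hz h)
  · exact Or.inr (Or.inl (key 1 _ _ hw hx h))
  · exact Or.inr (Or.inr (key 1 _ _ hy hz h))

end Patterns

/-! ### Labellings of a graph by tableaux -/

theorem units_eq_neg_iff : ∀ a b : ℤˣ, a = -b ↔ (a = 1 ↔ ¬ b = 1) := by decide

theorem units_eq_iff : ∀ a b : ℤˣ, a = b ↔ (a = 1 ↔ b = 1) := by decide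

section Graph

variable {V : Type*} [Finite V] {N : ℕ} {G : SignedColoredGraph V N N}

theorem upTo_adj {i : ℕ} {u v : V} :
    (G.upTo i).Adj u v ↔ ∃ j, 2 ≤ j ∧ j ≤ i ∧ (G.E j).Adj u v := by
  simp [SignedColoredGraph.upTo, SimpleGraph.iSup_adj, and_assoc]

theorem upTo_mono {i j : ℕ} (h : i ≤ j) : G.upTo i ≤ G.upTo j := by
  intro u v huv
  rw [upTo_adj] at *
  obtain ⟨k, h₁, h₂, h₃⟩ := huv
  exact ⟨k, h₁, h₂.trans h, h₃⟩

theorem reachable_of_adj {i j : ℕ} {u v : V} (h : (G.E j).Adj u v) (hj : 2 ≤ j) (hi : j ≤ i) :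
    (G.upTo i).Reachable u v :=
  (upTo_adj.2 ⟨j, hj, hi, h⟩ : (G.upTo i).Adj u v).reachable

/-- A labelling of the vertices of `G` by tableaux with `n` entries that is compatible with the
first signs and with the edges that affect only the entries up to `m`. -/
structure IsLabelling (G : SignedColoredGraph V N N) (n m : ℕ) (Φ : V → ℕ → ℕ × ℕ) : Prop where
  tab : ∀ v, IsTableau n (Φ v)
  -- Fixing the values outside `1, …, n` makes equality of labels the same as equality of tableaux.
  zero : ∀ v k, k = 0 ∨ n < k → Φ v k = 0
  sign : ∀ v i, 1 ≤ i → i < n → (G.sign v i = 1 ↔ Ascent (Φ v) i)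
  adj : ∀ i u v, 1 ≤ i → i + 2 ≤ m → (G.E (i + 1)).Adj u v → Φ v = dual i (Φ u)

namespace IsLabelling

variable {n m : ℕ} {Φ : V → ℕ → ℕ × ℕ}

theorem exists_adj_iff (hL : IsLabelling G n m Φ) (hG : G.IsDualEquivalenceGraph) (hn : n ≤ N)
    {i : ℕ} (hi : 1 ≤ i) (hi' : i + 2 ≤ n) (v : V) :
    (∃ x, (G.E (i + 1)).Adj v x) ↔ (Ascent (Φ v) i ↔ ¬ Ascent (Φ v) (i + 1)) := by
  rw [← hG.ax1 v (i + 1) (by omega) (by omega), Nat.add_sub_cancel, units_eq_neg_iff,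
    hL.sign v i hi (by omega), hL.sign v (i + 1) (by omega) (by omega)]

end IsLabelling

theorem IsTableau.btw_of_ascent_iff {m : ℕ} {t : ℕ → ℕ × ℕ} (ht : IsTableau m t) {i : ℕ}
    (hi : 1 ≤ i) (hi' : i + 2 ≤ m) (h : Ascent t i ↔ Ascent t (i + 1)) :
    Btw (content (t i)) (content (t (i + 1))) (content (t (i + 2))) := by
  have h₁ := ht.content_ne₁ hi (by omega)
  have h₂ := ht.content_ne₁ (i := i + 1) (by omega) hi'
  simp only [Ascent, Btw, Nat.add_assoc, Nat.reduceAdd] at *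
  omega

namespace IsLabelling

variable {n m : ℕ} {Φ : V → ℕ → ℕ × ℕ}

theorem exists_adj_or (hL : IsLabelling G n m Φ) (hG : G.IsDualEquivalenceGraph) (hn : n ≤ N)
    {i : ℕ} (hi : 1 ≤ i) (hi' : i + 2 ≤ n) (v : V) :
    (∃ x, (G.E (i + 1)).Adj v x) ∨ dual i (Φ v) = Φ v := by
  by_cases h : Ascent (Φ v) i ↔ Ascent (Φ v) (i + 1)
  · exact Or.inr (dual_of_btw ((hL.tab v).btw_of_ascent_iff hi hi' h))
  · exact Or.inl ((hL.exists_adj_iff hG hn hi hi' v).2 (by tauto))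

/-- By axiom 1 and the sign condition, a vertex without an edge of the required color has a label
fixed by that dual equivalence, so paths of tableaux lift to the graph. -/
theorem lift (hL : IsLabelling G n m Φ) (hG : G.IsDualEquivalenceGraph) (hn : n ≤ N)
    (hm : m ≤ n) {l : ℕ} (hl : l ≤ m) {v : V} {t : ℕ → ℕ × ℕ}
    (h : ReflTransGen (Step l) (Φ v) t) : ∃ u, (G.upTo (l - 1)).Reachable v u ∧ Φ u = t := by
  induction h with
  | refl => exact ⟨v, .refl _, rfl⟩
  | tail _ h₁ ih =>
    obtain ⟨i, hi, hi', rfl⟩ := h₁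
    obtain ⟨u, hu, rfl⟩ := ih
    rcases hL.exists_adj_or hG hn hi (by omega) u with ⟨x, hx⟩ | h
    · exact ⟨x, hu.trans (reachable_of_adj hx (by omega) (by omega)), hL.adj i u x hi (by omega) hx⟩
    · exact ⟨u, hu, h.symm⟩

/-! ### Edges of the newest color -/

section Edge

variable {f : ℕ}

/-- The color `i + 1` is at distance at least three from `f + 2`, so axiom 5 moves the edge. If `w`
has no such edge, axiom 2 gives `x` the same signs at `i` and `i + 1`, and both labels are fixed. -/
theorem exists_parallel (hL : IsLabelling G (f + 3) (f + 2) Φ) (hG : G.IsDualEquivalenceGraph)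
    (hf : f + 3 ≤ N) {w x : V} (h : (G.E (f + 2)).Adj w x) {i : ℕ} (hi : 1 ≤ i) (hi' : i + 2 ≤ f) :
    ∃ w' x', (G.E (f + 2)).Adj w' x' ∧ Φ w' = dual i (Φ w) ∧ Φ x' = dual i (Φ x) ∧
      (G.upTo (f + 1)).Reachable w w' ∧ (G.upTo (f + 1)).Reachable x x' := by
  by_cases he : ∃ w', (G.E (i + 1)).Adj w w'
  · obtain ⟨w', hw⟩ := he
    obtain ⟨x', h₁, h₂⟩ := hG.ax5 w' w x (i + 1) (f + 2) (by omega) (by omega) (by omega)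
      (by omega) (by omega) hw.symm h
    exact ⟨w', x', h₁, hL.adj i _ _ hi (by omega) hw, hL.adj i _ _ hi (by omega) h₂.symm,
      reachable_of_adj hw (by omega) (by omega), (reachable_of_adj h₂ (by omega) (by omega)).symm⟩
  · refine ⟨w, x, h, ?_, ?_, .refl _, .refl _⟩
    · exact (((hL.exists_adj_or hG hf hi (by omega) w).resolve_left he)).symm
    · refine ((hL.exists_adj_or hG hf hi (by omega) x).resolve_left ?_).symm
      rw [← hG.ax1 _ _ (by omega) (by omega), Nat.add_sub_cancel] at he ⊢
      rw [← hG.ax2_eq w x (f + 2) (by omega) (by omega) h i hi (by omega) (by omega),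
        ← hG.ax2_eq w x (f + 2) (by omega) (by omega) h (i + 1) (by omega) (by omega) (by omega)]
      exact he

/-- Being joined by an `(f + 2)`-edge is preserved by dual equivalences of entries up to `f`, and
axiom 2 equates the descents below `f`, so descents determine these entries. -/
theorem agree (hL : IsLabelling G (f + 3) (f + 2) Φ) (hG : G.IsDualEquivalenceGraph)
    (hf : f + 3 ≤ N) {w x : V} (h : (G.E (f + 2)).Adj w x) :
    ∀ k, 1 ≤ k → k ≤ f → Φ w k = Φ x k := by
  refine eq_of_ascent_iff
    (R := fun s t => ∃ w x, (G.E (f + 2)).Adj w x ∧ Φ w = s ∧ Φ x = t) ?_ ?_ ?_ ⟨w, x, h, rfl, rfl⟩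
  · rintro _ _ i ⟨w, x, h, rfl, rfl⟩ hi hi'
    obtain ⟨w', x', h₁, h₂, h₃, -⟩ := hL.exists_parallel hG hf h hi hi'
    exact ⟨w', x', h₁, h₂, h₃⟩
  · rintro _ _ ⟨w, x, -, rfl, rfl⟩
    exact ⟨(hL.tab w).mono (by omega), (hL.tab x).mono (by omega)⟩
  · rintro _ _ i ⟨w, x, h, rfl, rfl⟩ hi hi'
    rw [← hL.sign w i hi (by omega), ← hL.sign x i hi (by omega),
      hG.ax2_eq w x (f + 2) (by omega) (by omega) h i hi (by omega) (by omega)]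

/-- An edge of color `f + 2` may be moved parallel to itself by elementary dual equivalences of
entries at most `f`. -/
theorem exists_parallel_path (hL : IsLabelling G (f + 3) (f + 2) Φ) (hG : G.IsDualEquivalenceGraph)
    (hf : f + 3 ≤ N) {w x : V} (h : (G.E (f + 2)).Adj w x) {t : ℕ → ℕ × ℕ}
    (ht : ReflTransGen (Step f) (Φ w) t) :
    ∃ w' x', (G.E (f + 2)).Adj w' x' ∧ Φ w' = t ∧ (∀ k, f < k → Φ x' k = Φ x k) ∧
      (G.upTo (f + 1)).Reachable w w' ∧ (G.upTo (f + 1)).Reachable x x' := by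
  induction ht with
  | refl => exact ⟨w, x, h, rfl, fun _ _ => rfl, .refl _, .refl _⟩
  | tail _ h₁ ih =>
    obtain ⟨i, hi, hi', rfl⟩ := h₁
    obtain ⟨w', x', h₁, rfl, h₃, h₄, h₅⟩ := ih
    obtain ⟨w'', x'', h₆, h₇, h₈, h₉, h₁₀⟩ := hL.exists_parallel hG hf h₁ hi hi'
    refine ⟨w'', x'', h₆, h₇, fun k hk => ?_, h₄.trans h₉, h₅.trans h₁₀⟩
    rw [h₈, dual_apply_of_gt _ (by omega), h₃ k hk]

theorem not_ascent_iff (hL : IsLabelling G (f + 3) (f + 2) Φ) (hG : G.IsDualEquivalenceGraph)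
    (hf : f + 3 ≤ N) {w x : V} (h : (G.E (f + 2)).Adj w x) :
    (Ascent (Φ w) (f + 1) ↔ ¬ Ascent (Φ x) (f + 1)) ∧
    (Ascent (Φ w) (f + 2) ↔ ¬ Ascent (Φ x) (f + 2)) ∧
    (Ascent (Φ w) (f + 1) ↔ ¬ Ascent (Φ w) (f + 2)) := by
  obtain ⟨h₁, h₂⟩ := hG.ax2_neg w x (f + 2) (by omega) (by omega) h
  rw [show f + 2 - 1 = f + 1 from rfl, units_eq_neg_iff, hL.sign _ _ (by omega) (by omega),
    hL.sign _ _ (by omega) (by omega)] at h₁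
  rw [units_eq_neg_iff, hL.sign _ _ (by omega) (by omega),
    hL.sign _ _ (by omega) (by omega)] at h₂
  exact ⟨h₁, h₂, (hL.exists_adj_iff hG hf (by omega) le_rfl w).1 ⟨x, h⟩⟩

/-- Move `f` to a corner between the cells of `f + 1` and `f + 2`. The `(f + 1)`-edge at the new
vertex then exchanges these two entries, and its other end again has an `(f + 2)`-edge. The
two-color patterns force the two edges to coincide. The second conclusion is needed for injectivity
of the labels. -/
theorem adj_of_btw (hL : IsLabelling G (f + 3) (f + 2) Φ) (hG : G.IsDualEquivalenceGraph)
    (hf : f + 3 ≤ N) {w x : V} (h : (G.E (f + 2)).Adj w x)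
    (hb : Btw (content (Φ w (f + 1))) (content (Φ w (f + 3))) (content (Φ w (f + 2)))) :
    Φ x = dual (f + 1) (Φ w) ∧ (G.upTo (f + 1)).Reachable w x := by
  have ht : IsTableau (f + 2) (Φ w) := (hL.tab w).mono (by omega)
  have htf := ht.mono (l := f) (by omega)
  obtain ⟨c, hc, hcb⟩ := exists_corner_btw htf.isLowerSet (ht.mono (by omega)).addable
    (ht.addable_of_btw hb) (fun e => by rw [e] at hb; unfold Btw at hb; omega)
  obtain ⟨hf₁, t, hwt, rfl⟩ := htf.exists_path_last hc
  obtain ⟨w', x', h₁, rfl, h₃, h₄, h₅⟩ := hL.exists_parallel_path hG hf h hwt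
  have hgt : ∀ k, f < k → Φ w' k = Φ w k := fun k hk => Step.apply_of_gt hwt (Or.inr hk)
  rw [← hgt _ (by omega), ← hgt (f + 2) (by omega)] at hcb
  have hd : dual f (Φ w') = Φ w' ∘ Equiv.swap (f + 1) (f + 2) := dual_of_btw_left hcb
  obtain ⟨y, hy⟩ := (hL.exists_adj_iff hG hf hf₁ (by omega) w').2 (by
    simp only [Ascent, Btw, Nat.add_assoc, Nat.reduceAdd] at *
    omega)
  have hΦy := hL.adj f w' y hf₁ le_rfl hy
  rw [hd] at hΦy
  have hflip := hL.not_ascent_iff hG hf h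
  obtain ⟨z, hz⟩ := (hL.exists_adj_iff hG hf (i := f + 1) (by omega) le_rfl y).2 (by
    have e₁ : Φ y (f + 1) = Φ w (f + 2) := by simp [hΦy, hgt]
    have e₂ : Φ y (f + 2) = Φ w (f + 1) := by simp [hΦy, hgt]
    have e₃ : Φ y (f + 3) = Φ w (f + 3) := by
      rw [hΦy, Function.comp_apply, swap_of_gt (by omega), hgt _ (by omega)]
    simp only [Ascent, Btw, Nat.add_assoc, Nat.reduceAdd] at *
    rw [e₁, e₂, e₃]
    omega)
  have hyx : y = x' :=
    eq_of_twoColorPatterns (A := G.E (f + 1)) (hG.ax4_two (f + 2) (by omega) (by omega)) hy h₁ hz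
  subst hyx
  refine ⟨?_, (h₄.trans (reachable_of_adj hy (by omega) le_rfl)).trans h₅.symm⟩
  rw [dual_of_btw_right hb]
  funext k
  rw [Function.comp_apply]
  by_cases hk : f < k
  · rw [← h₃ k hk, hΦy, Function.comp_apply, hgt]
    rw [Equiv.swap_apply_def]
    split_ifs <;> omega
  · rw [swap_of_gt (by omega)]
    rcases Nat.eq_zero_or_pos k with rfl | hk₀
    · rw [hL.zero _ _ (Or.inl rfl), hL.zero _ _ (Or.inl rfl)]
    · exact (hL.agree hG hf h k hk₀ (by omega)).symm

theorem adj_eq_of_apply_eq (hL : IsLabelling G (f + 3) (f + 2) Φ) (hG : G.IsDualEquivalenceGraph)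
    (hf : f + 3 ≤ N) {w x : V} (h : (G.E (f + 2)).Adj w x)
    (h₁ : Φ x (f + 1) = Φ w (f + 1)) (h₂ : Φ x (f + 2) = Φ w (f + 3))
    (h₃ : Φ x (f + 3) = Φ w (f + 2))
    (hb : Btw (content (Φ w (f + 2))) (content (Φ w (f + 1))) (content (Φ w (f + 3)))) :
    Φ x = dual (f + 1) (Φ w) := by
  rw [dual_of_btw_left hb]
  funext k
  rw [Function.comp_apply]
  by_cases k₂ : k = f + 2
  · subst k₂; rw [Equiv.swap_apply_left, h₂]
  by_cases k₃ : k = f + 3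
  · subst k₃; rw [Equiv.swap_apply_right, h₃]
  rw [Equiv.swap_apply_of_ne_of_ne k₂ k₃]
  by_cases k₁ : k = f + 1
  · subst k₁; exact h₁
  by_cases hk : 1 ≤ k ∧ k ≤ f
  · exact (hL.agree hG hf h k hk.1 hk.2).symm
  · rw [hL.zero _ _ (by omega), hL.zero _ _ (by omega)]

/-- When `f + 1` lies between `f + 2` and `f + 3`, the `(f + 2)`-edge is not an `(f + 1)`-edge. -/
theorem not_adj_of_btw (hL : IsLabelling G (f + 3) (f + 2) Φ) (hG : G.IsDualEquivalenceGraph)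
    (hf : f + 3 ≤ N) (hf₁ : 1 ≤ f) {w x : V} (h : (G.E (f + 2)).Adj w x)
    (hb : Btw (content (Φ w (f + 2))) (content (Φ w (f + 1))) (content (Φ w (f + 3)))) :
    ¬ (G.E (f + 1)).Adj w x := by
  intro h₁
  have hd := hL.adj f w x hf₁ le_rfl h₁
  have hflip := hL.not_ascent_iff hG hf h
  have e₃ : Φ x (f + 3) = Φ w (f + 3) := by rw [hd, dual_apply_of_gt _ (by omega)]
  simp only [Ascent, Nat.add_assoc, Nat.reduceAdd] at hflip
  rw [e₃] at hflip
  -- The entry `f + 3` stays put, and in each case the new cell of `f + 2` is on the same side of it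
  -- as the old one, so the sign at `f + 2` cannot flip.
  rcases (hL.tab w).btw_cases hf₁ (by omega) with hc | hc | hc
  · rw [hd, dual_of_btw hc] at hflip
    omega
  · rw [hd, dual_of_btw_left hc] at hflip
    simp only [Function.comp_apply, Equiv.swap_apply_right] at hflip
    unfold Btw at hb
    omega
  · rw [hd, dual_of_btw_right hc] at hflip
    rw [Function.comp_apply, Function.comp_apply, swap_of_gt (k := f + 2) (by omega)] at hflip
    omega

/-- The position of `f + 1` is the same at the ends of an `(f + 2)`-edge, when it lies between
those of `f + 2` and `f + 3`. -/
theorem apply_eq_of_btw (hL : IsLabelling G (f + 3) (f + 2) Φ) (hG : G.IsDualEquivalenceGraph)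
    (hf : f + 3 ≤ N) {w x : V} (h : (G.E (f + 2)).Adj w x)
    (hb : Btw (content (Φ w (f + 2))) (content (Φ w (f + 1))) (content (Φ w (f + 3)))) :
    Φ w (f + 1) = Φ x (f + 1) := by
  by_contra hne
  have htw : IsTableau (f + 1) (Φ w) := (hL.tab w).mono (by omega)
  have htx : IsTableau (f + 1) (Φ x) := (hL.tab x).mono (by omega)
  have hax := htx.addable
  rw [← shape_congr (hL.agree hG hf h)] at hax
  have htf := htw.mono (l := f) (by omega)
  obtain ⟨c, hc, hcb⟩ := exists_corner_btw htf.isLowerSet htw.addable hax hne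
  obtain ⟨hf₁, t, hwt, rfl⟩ := htf.exists_path_last hc
  obtain ⟨w', x', h₁, rfl, h₃, -, -⟩ := hL.exists_parallel_path hG hf h hwt
  have hgt : ∀ k, f < k → Φ w' k = Φ w k := fun k hk => Step.apply_of_gt hwt (Or.inr hk)
  have e := hL.agree hG hf h₁ f hf₁ le_rfl
  have hflip := hL.not_ascent_iff hG hf h₁
  have hw' := hL.exists_adj_iff hG hf (i := f) hf₁ (by omega) w'
  have hx' := hL.exists_adj_iff hG hf (i := f) hf₁ (by omega) x'
  have h4 := hG.ax4_two (f + 2) (by omega) (by omega)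
  rw [← hgt (f + 1) (by omega), ← hgt (f + 2) (by omega), ← hgt (f + 3) (by omega)] at hb
  rw [← hgt (f + 1) (by omega), ← h₃ (f + 1) (by omega)] at hcb
  have hnot := hL.not_adj_of_btw hG hf hf₁ h₁ hb
  -- The entry `f` now separates the two cells of `f + 1`, so the signs at `f` and at `f + 1` both
  -- differ between the ends. Hence both ends or neither have an `(f + 1)`-edge; the patterns
  -- exclude neither, and both would give a double edge.
  have hiff : (∃ y, (G.E (f + 1)).Adj w' y) ↔ ∃ z, (G.E (f + 1)).Adj x' z := by
    rw [hw', hx']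
    simp only [Ascent, Btw, Nat.add_assoc, Nat.reduceAdd] at *
    rw [← e]
    omega
  have hor : (∃ y, (G.E (f + 1)).Adj w' y) ∨ ∃ z, (G.E (f + 1)).Adj x' z :=
    exists_of_twoColorPatterns (A := G.E (f + 1)) h4 h₁
  obtain ⟨y, hy⟩ := hor.elim id hiff.2
  obtain ⟨z, hz⟩ := hiff.1 ⟨y, hy⟩
  have := eq_of_twoColorPatterns' (A := G.E (f + 1)) h4 h₁ hy hz
  exact hnot (this ▸ hy)

/-- Otherwise `x` falls under `adj_of_btw`, and exchanging `f + 1` and `f + 2` leaves `f + 3` in the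
middle at `w` too. -/
theorem btw_of_btw (hL : IsLabelling G (f + 3) (f + 2) Φ) (hG : G.IsDualEquivalenceGraph)
    (hf : f + 3 ≤ N) {w x : V} (h : (G.E (f + 2)).Adj w x)
    (hb : Btw (content (Φ w (f + 2))) (content (Φ w (f + 1))) (content (Φ w (f + 3)))) :
    Btw (content (Φ x (f + 2))) (content (Φ x (f + 1))) (content (Φ x (f + 3))) := by
  rcases (hL.tab x).btw_cases (i := f + 1) (by omega) le_rfl with hc | hc | hc
  · have := (hL.not_ascent_iff hG hf h.symm).2.2
    simp only [Ascent, Btw, Nat.add_assoc, Nat.reduceAdd] at *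
    omega
  · exact hc
  · have hd := (hL.adj_of_btw hG hf h.symm hc).1
    rw [dual_of_btw_right hc] at hd
    rw [hd] at hb
    simp only [Nat.add_assoc, Nat.reduceAdd] at hc
    simp only [Function.comp_apply, Nat.add_assoc, Nat.reduceAdd, Equiv.swap_apply_left,
      Equiv.swap_apply_right] at hb
    rw [swap_of_gt (i := f + 1) (by omega)] at hb
    unfold Btw at *
    omega

/-- An `f`-edge can bring `f + 1` to the corner `k` without touching `f + 2` and `f + 3`. The
three-color patterns carry this edge across to the other end, where `apply_eq_of_btw` and
`btw_of_btw` apply. -/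
theorem btw_corner (hL : IsLabelling G (f + 3) (f + 2) Φ) (hG : G.IsDualEquivalenceGraph)
    (hf : f + 3 ≤ N) {w x : V} (h : (G.E (f + 2)).Adj w x)
    (hb : Btw (content (Φ w (f + 2))) (content (Φ w (f + 1))) (content (Φ w (f + 3))))
    {k : ℕ × ℕ} (hk : Corner (shape (Φ w) (f + 1)) k)
    (hkb : Btw (content (Φ w (f + 2))) (content k) (content (Φ w (f + 3)))) :
    Btw (content (Φ x (f + 2))) (content k) (content (Φ x (f + 3))) := by
  by_cases hne : k = Φ w (f + 1)
  · rw [hne, hL.apply_eq_of_btw hG hf h hb]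
    exact hL.btw_of_btw hG hf h hb
  obtain ⟨e, t, he, hwt, rfl, hbt⟩ :=
    ((hL.tab w).mono (by omega)).exists_path_last_two hk hne
  obtain rfl : f = e + 2 := by omega
  obtain ⟨w', x', h₁, rfl, h₃, -, -⟩ := hL.exists_parallel_path hG hf h hwt
  have hgt : ∀ k, e + 2 < k → Φ w' k = Φ w k := fun k hk => Step.apply_of_gt hwt (Or.inr hk)
  have hd : dual (e + 1) (Φ w') = Φ w' ∘ Equiv.swap (e + 2) (e + 3) := dual_of_btw_left hbt
  obtain ⟨y, hy⟩ := (hL.exists_adj_iff hG hf (i := e + 1) (by omega) (by omega) w').2 (by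
    simp only [Ascent, Btw, Nat.add_assoc, Nat.reduceAdd] at *
    omega)
  have hΦy := hL.adj (e + 1) w' y (by omega) (by omega) hy
  rw [hd] at hΦy
  have hy₃ : Φ y (e + 3) = Φ w' (e + 2) := by simp [hΦy]
  have hy₄ : Φ y (e + 4) = Φ w (e + 4) := by
    rw [hΦy, Function.comp_apply, swap_of_gt (by omega), hgt _ (by omega)]
  have hy₅ : Φ y (e + 5) = Φ w (e + 5) := by
    rw [hΦy, Function.comp_apply, swap_of_gt (by omega), hgt _ (by omega)]
  have hyb : Btw (content (Φ y (e + 4))) (content (Φ y (e + 3))) (content (Φ y (e + 5))) := by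
    rwa [hy₃, hy₄, hy₅]
  obtain ⟨z, hz⟩ := (hL.exists_adj_iff hG hf (i := e + 3) (by omega) le_rfl y).2 (by
    simp only [Ascent, Btw, Nat.add_assoc, Nat.reduceAdd] at *
    omega)
  have hwb : Btw (content (Φ w' (e + 4))) (content (Φ w' (e + 3))) (content (Φ w' (e + 5))) := by
    rwa [hgt _ (by omega), hgt _ (by omega), hgt _ (by omega)]
  have h4 := adj_of_threeColorPatterns (A := G.E (e + 2)) (B := G.E (e + 3))
    (hG.ax4_three (e + 4) (by omega) (by omega)) h₁ hy hz
  have hxz : (G.E (e + 2)).Adj x' z := by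
    rcases h4 with h4 | h4 | h4
    · exact h4
    · exact absurd h4 (hL.not_adj_of_btw hG hf (by omega) h₁ hwb)
    · exact absurd h4 (hL.not_adj_of_btw hG hf (by omega) hz hyb)
  have hΦz := hL.adj (e + 1) x' z (by omega) (by omega) hxz
  have hzb := hL.btw_of_btw hG hf hz hyb
  have e₃ : Φ z (e + 3) = Φ y (e + 3) := (hL.apply_eq_of_btw hG hf hz hyb).symm
  have e₄ : Φ z (e + 4) = Φ x (e + 4) := by
    rw [hΦz, dual_apply_of_gt _ (by omega), h₃ _ (by omega)]
  have e₅ : Φ z (e + 5) = Φ x (e + 5) := by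
    rw [hΦz, dual_apply_of_gt _ (by omega), h₃ _ (by omega)]
  rw [e₃, hy₃] at hzb
  rwa [← e₄, ← e₅]

/-- The edges of color `f + 2` are elementary dual equivalences. -/
theorem adj_succ (hL : IsLabelling G (f + 3) (f + 2) Φ) (hG : G.IsDualEquivalenceGraph)
    (hf : f + 3 ≤ N) {w x : V} (h : (G.E (f + 2)).Adj w x) : Φ x = dual (f + 1) (Φ w) := by
  have hflip := hL.not_ascent_iff hG hf h
  rcases (hL.tab w).btw_cases (i := f + 1) (by omega) le_rfl with hb | hb | hb
  · simp only [Ascent, Btw, Nat.add_assoc, Nat.reduceAdd] at *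
    omega
  swap
  · exact (hL.adj_of_btw hG hf h hb).1
  simp only [Nat.add_assoc, Nat.reduceAdd] at hb
  have h₁ := hL.apply_eq_of_btw hG hf h hb
  have hb' := hL.btw_of_btw hG hf h hb
  have htw := hL.tab w
  have htx := hL.tab x
  have hsh : shape (Φ w) (f + 1) = shape (Φ x) (f + 1) := shape_congr fun k hk hk' => by
    by_cases hkf : k ≤ f
    · exact hL.agree hG hf h k hk hkf
    · rwa [show k = f + 1 by omega]
  have hw₂ : Addable (shape (Φ w) (f + 1)) (Φ w (f + 2)) := (htw.mono (by omega)).addable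
  have hw₃ : Addable (shape (Φ w) (f + 1)) (Φ w (f + 3)) := htw.addable_of_btw hb
  have hx₂ : Addable (shape (Φ x) (f + 1)) (Φ x (f + 2)) := (htx.mono (by omega)).addable
  have hx₃ : Addable (shape (Φ x) (f + 1)) (Φ x (f + 3)) := htx.addable_of_btw hb'
  have hlow := (htw.mono (l := f + 1) (by omega)).isLowerSet
  have key : ∀ {k}, Corner (shape (Φ w) (f + 1)) k →
      (Btw (content (Φ w (f + 2))) (content k) (content (Φ w (f + 3))) ↔
      Btw (content (Φ x (f + 2))) (content k) (content (Φ x (f + 3)))) := fun {k} hk =>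
    ⟨hL.btw_corner hG hf h hb hk, hL.btw_corner hG hf h.symm hb' (hsh ▸ hk)⟩
  rw [← hsh] at hx₂ hx₃
  rw [← h₁] at hb'
  simp only [Ascent, Nat.add_assoc, Nat.reduceAdd] at hflip
  refine hL.adj_eq_of_apply_eq hG hf h h₁.symm ?_ ?_ hb
  · by_contra hne
    -- The pairs of cells of `f + 2` and `f + 3` are oppositely oriented at `w` and `x` and both
    -- surround the common cell of `f + 1`, so `k` would lie between the cells of just one pair.
    obtain ⟨k, hk, hkb⟩ := exists_corner_btw hlow hx₂ hw₃ hne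
    have := key hk
    unfold Btw at *
    omega
  · by_contra hne
    obtain ⟨k, hk, hkb⟩ := exists_corner_btw hlow hx₃ hw₂ hne
    have := key hk
    unfold Btw at *
    omega

end Edge

end IsLabelling

end Graph

/-! ### Adding one entry to a labelling -/

section Graph

variable {V : Type*} [Finite V] {N : ℕ} {G : SignedColoredGraph V N N}

theorem eq_of_reachable_upTo {i : ℕ} (hi : i ≤ 1) {u v : V} (h : (G.upTo i).Reachable u v) :
    u = v := by
  rw [SimpleGraph.reachable_iff_reflTransGen] at h
  induction h with
  | refl => rfl
  | tail _ h₁ _ =>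
    obtain ⟨j, h₂, h₃, -⟩ := upTo_adj.1 h₁
    omega

namespace IsLabelling

variable {n m : ℕ} {Φ : V → ℕ → ℕ × ℕ}

theorem steps_of_reachable (hL : IsLabelling G n m Φ) {l : ℕ} (hl : l ≤ m) {u v : V}
    (h : (G.upTo (l - 1)).Reachable u v) : ReflTransGen (Step l) (Φ u) (Φ v) := by
  rw [SimpleGraph.reachable_iff_reflTransGen] at h
  induction h with
  | refl => exact .refl
  | tail _ h₁ ih =>
    obtain ⟨j, h₂, h₃, h₄⟩ := upTo_adj.1 h₁
    obtain ⟨i, rfl⟩ : ∃ i, j = i + 1 := ⟨j - 1, by omega⟩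
    exact ih.tail ⟨i, by omega, by omega, hL.adj i _ _ (by omega) (by omega) h₄⟩

theorem exists_reachable (hL : IsLabelling G n n Φ) (hG : G.IsDualEquivalenceGraph) (hn : n ≤ N)
    {l : ℕ} (hl : l ≤ n) {v : V} {t : ℕ → ℕ × ℕ} (ht : IsTableau l t)
    (hs : shape (Φ v) l = shape t l) (h : ∀ k, k = 0 ∨ l < k → Φ v k = t k) :
    ∃ u, (G.upTo (l - 1)).Reachable v u ∧ Φ u = t :=
  hL.lift hG hn le_rfl hl (((hL.tab v).mono hl).connected ht hs h)

theorem sign_eq_of_reachable (hG : G.IsDualEquivalenceGraph) {l h : ℕ} (hl : l + 1 < h)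
    (hh : h < N) {u v : V} (huv : (G.upTo l).Reachable u v) : G.sign u h = G.sign v h := by
  rw [SimpleGraph.reachable_iff_reflTransGen] at huv
  induction huv with
  | refl => rfl
  | tail _ h₁ ih =>
    obtain ⟨j, h₂, h₃, h₄⟩ := upTo_adj.1 h₁
    rw [ih, hG.ax2_eq _ _ j (by omega) (by omega) h₄ h (by omega) hh (by omega)]

/-- In a component of the edges of color less than `n`, the sign at `n` depends only on the
position of the entry `n`. -/
theorem sign_eq_of_apply_eq (hL : IsLabelling G (n + 1) (n + 1) Φ)
    (hI : ∀ u v, (G.upTo n).Reachable u v → Φ u = Φ v → u = v)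
    (hG : G.IsDualEquivalenceGraph) (hn : n + 1 < N) {u v : V} (huv : (G.upTo n).Reachable u v)
    (h : Φ u (n + 1) = Φ v (n + 1)) : G.sign u (n + 1) = G.sign v (n + 1) := by
  -- The tableaux differ only in the entries up to `n`, so colors below `n` lead from `u` to a
  -- vertex with the label of `v`. That vertex is `v`, and by axiom 2 these colors do not affect the
  -- sign at `n + 1`.
  obtain ⟨w, hw, hwv⟩ := hL.exists_reachable hG hn.le (Nat.le_succ n) (v := u)
    ((hL.tab v).mono (Nat.le_succ n))
    (by rw [(hL.tab u).shape_erase, (hL.tab v).shape_erase, h,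
      Step.shape_eq le_rfl (hL.steps_of_reachable le_rfl huv)])
    (fun k hk => by
      by_cases hk' : k = n + 1
      · rw [hk', h]
      · rw [hL.zero _ _ (by omega), hL.zero _ _ (by omega)])
  rw [← hI w v ((hw.mono (upTo_mono (Nat.sub_le n 1))).symm.trans huv) hwv]
  rcases Nat.eq_zero_or_pos n with rfl | hn₀
  · rw [eq_of_reachable_upTo (by omega) hw]
  · exact sign_eq_of_reachable hG (by omega) hn hw

/-- The cells of `n` occurring with sign `+1` at `n` form an initial segment of the corners by
content. To compare two corners, an `(n - 1)`-edge exchanges `n - 1` and `n` between them. -/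
theorem exists_addable (hL : IsLabelling G n n Φ)
    (hI : ∀ u v, (G.upTo (n - 1)).Reachable u v → Φ u = Φ v → u = v)
    (hG : G.IsDualEquivalenceGraph) (hn : n < N) (C : (G.upTo (n - 1)).ConnectedComponent) :
    ∃ a, ∀ v, (G.upTo (n - 1)).connectedComponentMk v = C → Addable (shape (Φ v) n) a ∧
      (1 ≤ n → (G.sign v n = 1 ↔ content (Φ v n) < content a)) := by
  induction C using SimpleGraph.ConnectedComponent.ind with | _ v₀
  have hlow := (hL.tab v₀).isLowerSet
  obtain ⟨a, ha, hac⟩ := exists_addable_threshold hlow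
    (fun k => ∃ u, (G.upTo (n - 1)).Reachable v₀ u ∧ Φ u n = k ∧ G.sign u n = 1) (by
    rintro k l hk hl hkl ⟨u₀, hu₀, rfl, hs⟩
    obtain ⟨hn₁, t, hvt, rfl⟩ := (hL.tab v₀).exists_path_last hk
    have ht := Step.isTableau le_rfl hvt (hL.tab v₀)
    obtain ⟨e, t', rfl, htt', h₁, hb⟩ := ht.exists_path_last_two
      (Step.shape_eq le_rfl hvt ▸ hl) (fun e => by rw [e] at hkl; exact lt_irrefl _ hkl)
    obtain ⟨u, hu, rfl⟩ := hL.lift hG hn.le le_rfl le_rfl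
      (hvt.trans (ReflTransGen.mono (fun _ _ => Step.mono (Nat.le_succ _)) _ _ htt'))
    have h₂ : Φ u (e + 3) = t (e + 3) := Step.apply_of_gt htt' (by omega)
    obtain ⟨y, hy⟩ := (hL.exists_adj_iff hG hn.le (i := e + 1) (by omega) le_rfl u).2 (by
      simp only [Ascent, Btw, Nat.add_assoc, Nat.reduceAdd] at *
      omega)
    have hd : dual (e + 1) (Φ u) = Φ u ∘ Equiv.swap (e + 2) (e + 3) := dual_of_btw_left hb
    have hΦy := hL.adj (e + 1) u y (by omega) le_rfl hy
    have huy : (G.upTo (e + 2)).Reachable u y := reachable_of_adj hy (by omega) le_rfl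
    have hy₁ : G.sign y (e + 3) = 1 := by
      rw [← hs]
      refine hL.sign_eq_of_apply_eq hI hG hn ((hu.trans huy).symm.trans hu₀) ?_
      rw [hΦy, hd, Function.comp_apply, Equiv.swap_apply_right, h₁]
    refine ⟨u, hu, h₂, ?_⟩
    by_contra hne
    -- If the sign at `n` changed along this edge, axiom 3 would make `n - 1` an ascent of `u`, but
    -- there `n - 1` sits at `l`, to the right of `n` at `k`.
    have h₃ := hG.ax3_right u y (e + 2) (by omega) (by omega) (by omega) hy
      (by rw [units_eq_neg_iff]; tauto)
    rw [units_eq_neg_iff, hL.sign u (e + 2) (by omega) (by omega)] at h₃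
    refine hne (h₃.2 ?_)
    unfold Ascent
    rw [h₁, show e + 2 + 1 = e + 3 from rfl, h₂]
    exact not_lt.2 hkl.le)
  refine ⟨a, fun v hv => ?_⟩
  have hv' : (G.upTo (n - 1)).Reachable v₀ v := (SimpleGraph.ConnectedComponent.exact hv).symm
  have hsh := Step.shape_eq le_rfl (hL.steps_of_reachable le_rfl hv')
  refine ⟨by rwa [hsh], fun hn₁ => ?_⟩
  rw [← hac (Φ v n) (hsh ▸ (hL.tab v).corner hn₁)]
  refine ⟨fun h => ⟨v, hv', rfl, h⟩, ?_⟩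
  rintro ⟨u, hu, h₁, h₂⟩
  obtain ⟨l, rfl⟩ : ∃ l, n = l + 1 := ⟨n - 1, by omega⟩
  rw [← h₂, hL.sign_eq_of_apply_eq hI hG hn (hu.symm.trans hv') h₁]

theorem exists_succ (hL : IsLabelling G n n Φ)
    (hI : ∀ u v, (G.upTo (n - 1)).Reachable u v → Φ u = Φ v → u = v)
    (hG : G.IsDualEquivalenceGraph) (hn : n < N) :
    ∃ Ψ, IsLabelling G (n + 1) (n + 1) Ψ ∧
      ∀ u v, (G.upTo n).Reachable u v → Ψ u = Ψ v → u = v := by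
  choose A hA using hL.exists_addable hI hG hn
  set Ψ : V → ℕ → ℕ × ℕ := fun v =>
    Function.update (Φ v) (n + 1) (A ((G.upTo (n - 1)).connectedComponentMk v)) with hΨ
  have hlast : ∀ v, Ψ v (n + 1) = A ((G.upTo (n - 1)).connectedComponentMk v) :=
    fun v => Function.update_self ..
  have hne : ∀ v k, k ≠ n + 1 → Ψ v k = Φ v k := fun v k hk => Function.update_of_ne hk ..
  -- The entry `n + 1` is constant on components of the smaller colors, so their edges remain dual
  -- equivalences. Only color `n` is left.
  have hpre : IsLabelling G (n + 1) n Ψ := by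
    refine ⟨fun v => ?_, fun v k hk => ?_, fun v i hi hi' => ?_, fun i u v hi hi' huv => ?_⟩
    · have h : ∀ k, 1 ≤ k → k ≤ n → Φ v k = Ψ v k := fun k _ hk => (hne v k (by omega)).symm
      refine ((hL.tab v).congr h).succ ?_
      rw [← shape_congr h, hlast]
      exact (hA _ v rfl).1
    · rw [hne v k (by omega), hL.zero v k (by omega)]
    · unfold Ascent
      rcases Nat.lt_or_eq_of_le (Nat.le_of_lt_succ hi') with h | rfl
      · rw [hne _ _ (by omega), hne _ _ (by omega)]
        exact hL.sign v i hi h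
      · rw [hne _ _ (by omega), hlast]
        exact (hA _ v rfl).2 hi
    · have h : (G.upTo (n - 1)).Reachable u v := reachable_of_adj huv (by omega) (by omega)
      rw [hΨ]
      dsimp only
      rw [dual_update _ _ (by omega), hL.adj i u v hi hi' huv,
        SimpleGraph.ConnectedComponent.sound h]
  refine ⟨Ψ, ⟨hpre.tab, hpre.zero, hpre.sign, fun i u v hi hi' huv => ?_⟩, fun u v huv he => ?_⟩
  · rcases Nat.lt_or_eq_of_le hi' with h | h
    · exact hpre.adj i u v hi (by omega) huv
    · obtain ⟨f, rfl⟩ : ∃ f, n = f + 2 := ⟨n - 2, by omega⟩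
      obtain rfl : i = f + 1 := by omega
      exact hpre.adj_succ hG hn huv
  · have hcomp : (G.upTo (n - 1)).Reachable u v → u = v := fun h => hI u v h (by
      funext k
      by_cases hk : k = n + 1
      · rw [hk, hL.zero _ _ (by omega), hL.zero _ _ (by omega)]
      · rw [← hne u k hk, he, hne v k hk])
    have hcell : ∀ {x y}, (G.upTo (n - 1)).Reachable x y → Ψ x (n + 1) = Ψ y (n + 1) := by
      intro x y hxy
      rw [hlast, hlast, SimpleGraph.ConnectedComponent.sound hxy]
    by_cases hn₁ : n ≤ 1
    · exact eq_of_reachable_upTo hn₁ huv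
    -- With at most one `n`-edge crossed, equal labels at `u` and `v` force `n + 1` to keep its cell
    -- along that edge. The edge then exchanges `n - 1` and `n`, so its ends already lie in one
    -- smaller component.
    obtain ⟨x, y, hux, hxy, hyv⟩ := hG.ax6 n (by omega) hn u v huv
    rcases hxy with rfl | hxy
    · exact hcomp (hux.trans hyv)
    obtain ⟨f, rfl⟩ : ∃ f, n = f + 2 := ⟨n - 2, by omega⟩
    have hd := hpre.adj_succ hG hn hxy
    have hx : Ψ y (f + 3) = Ψ x (f + 3) := by
      rw [← hcell hux, he, ← hcell hyv]
    have htab := hpre.tab x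
    rcases htab.btw_cases (i := f + 1) (by omega) le_rfl with hb | hb | hb
    · have := (hpre.not_ascent_iff hG hn hxy).2.2
      simp only [Ascent, Btw, Nat.add_assoc, Nat.reduceAdd] at this hb
      omega
    · rw [hd, dual_of_btw_left hb, Function.comp_apply, show f + 1 + 2 = f + 3 from rfl,
        Equiv.swap_apply_right] at hx
      have := htab.inj _ _ (by omega) (by omega) (by omega) (by omega) hx
      omega
    · exact hcomp (hux.trans ((hpre.adj_of_btw hG hn hxy hb).2.trans hyv))

end IsLabelling

theorem exists_isLabelling (hG : G.IsDualEquivalenceGraph) {n : ℕ} (hn : n ≤ N) :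
    ∃ Φ, IsLabelling G n n Φ ∧ ∀ u v, (G.upTo (n - 1)).Reachable u v → Φ u = Φ v → u = v := by
  induction n with
  | zero =>
    refine ⟨fun _ _ => 0, ⟨fun v => ⟨by omega, by omega⟩, fun _ _ _ => rfl, by omega, by omega⟩,
      fun u v huv _ => eq_of_reachable_upTo (by omega) huv⟩
  | succ n ih =>
    obtain ⟨Φ, hL, hI⟩ := ih (by omega)
    exact hL.exists_succ hI hG hn

end Graph

/-! ### Partitions and Young diagrams -/

section Partition

theorem card_cellsOfRowLens (w : List ℕ) : (YoungDiagram.cellsOfRowLens w).card = w.sum := by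
  induction w with
  | nil => rfl
  | cons a w ih =>
    rw [YoungDiagram.cellsOfRowLens, Finset.card_union_of_disjoint, Finset.card_map, ih,
      List.sum_cons]
    · simp
    · rw [Finset.disjoint_left]
      simp

theorem card_ofRowLens (w : List ℕ) (hw : w.SortedGE) : (YoungDiagram.ofRowLens w hw).card = w.sum :=
  card_cellsOfRowLens w

theorem ofRowLens_congr {w w' : List ℕ} (h : w = w') (hw : w.SortedGE) (hw' : w'.SortedGE) :
    YoungDiagram.ofRowLens w hw = YoungDiagram.ofRowLens w' hw' := by
  subst h
  rfl

theorem card_toYoungDiagram {n : ℕ} (p : n.Partition) : p.toYoungDiagram.card = n := by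
  rw [Nat.Partition.toYoungDiagram, card_ofRowLens, ← Multiset.sum_coe, Multiset.sort_eq,
    p.parts_sum]

theorem toYoungDiagram_injective {n : ℕ} {p q : n.Partition}
    (h : p.toYoungDiagram = q.toYoungDiagram) : p = q := by
  have key : ∀ p : n.Partition, p.toYoungDiagram.rowLens = p.parts.sort (· ≥ ·) := fun p =>
    YoungDiagram.rowLens_ofRowLens_eq_self fun x hx => p.parts_pos ((Multiset.mem_sort _).1 hx)
  have h₁ := congrArg YoungDiagram.rowLens h
  rw [key, key] at h₁
  refine Nat.Partition.ext ?_
  rw [← Multiset.sort_eq p.parts (· ≥ ·), h₁, Multiset.sort_eq]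

theorem exists_toYoungDiagram_eq (μ : YoungDiagram) {n : ℕ} (hn : μ.card = n) :
    ∃ p : n.Partition, p.toYoungDiagram = μ := by
  have hs : ((μ.rowLens : Multiset ℕ)).sort (· ≥ ·) = μ.rowLens := by
    rw [Multiset.coe_sort]
    exact List.mergeSort_eq_self _ (by simpa using μ.rowLens_sorted.pairwise)
  refine ⟨⟨μ.rowLens, fun {i} hi => μ.pos_of_mem_rowLens i hi, ?_⟩, ?_⟩
  · rw [Multiset.sum_coe, ← card_ofRowLens _ μ.rowLens_sorted,
      YoungDiagram.ofRowLens_to_rowLens_eq_self, hn]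
  · exact (ofRowLens_congr hs _ μ.rowLens_sorted).trans YoungDiagram.ofRowLens_to_rowLens_eq_self

end Partition

/-! ### Standard Young tableaux and the standard graph in terms of words -/

section Word

variable {μ : YoungDiagram} (T U : StandardYoungTableau μ)

open Classical in
/-- The word of cells of a standard tableau, in the order of their entries. -/
noncomputable def word (k : ℕ) : ℕ × ℕ :=
  if h : ∃ x ∈ μ.cells, T.entry x.1 x.2 = k then h.choose else 0

variable {T U}

theorem entry_mem {x : ℕ × ℕ} (hx : x ∈ μ.cells) :
    1 ≤ T.entry x.1 x.2 ∧ T.entry x.1 x.2 ≤ μ.card := T.bijOn.mapsTo hx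

theorem entry_eq_zero {x : ℕ × ℕ} (hx : x ∉ μ.cells) : T.entry x.1 x.2 = 0 := T.zeros' hx

theorem word_spec {k : ℕ} (hk : 1 ≤ k) (hk' : k ≤ μ.card) :
    word T k ∈ μ.cells ∧ T.entry (word T k).1 (word T k).2 = k := by
  have h : ∃ x ∈ μ.cells, T.entry x.1 x.2 = k := T.bijOn.surjOn ⟨hk, hk'⟩
  rw [word, dif_pos h]
  exact h.choose_spec

theorem word_entry {x : ℕ × ℕ} (hx : x ∈ μ.cells) : word T (T.entry x.1 x.2) = x := by
  obtain ⟨h₁, h₂⟩ := word_spec (T := T) (entry_mem hx).1 (entry_mem hx).2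
  exact T.bijOn.injOn h₁ hx h₂

theorem word_of_gt {k : ℕ} (hk : k = 0 ∨ μ.card < k) : word T k = 0 := by
  refine dif_neg ?_
  rintro ⟨x, hx, rfl⟩
  have := entry_mem (T := T) hx
  omega

theorem shape_word : shape (word T) μ.card = μ.cells := by
  ext x
  rw [mem_shape]
  constructor
  · rintro ⟨j, h₁, h₂, rfl⟩
    exact (word_spec h₁ h₂).1
  · exact fun hx => ⟨_, (entry_mem hx).1, (entry_mem hx).2, word_entry hx⟩

theorem isTableau_word : IsTableau μ.card (word T) := by
  refine ⟨fun i j h₁ h₂ h₃ h₄ e => ?_, fun i h₁ h₂ x hx => ?_⟩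
  · rw [← (word_spec (T := T) h₁ h₂).2, e, (word_spec h₃ h₄).2]
  · obtain ⟨h₃, h₄⟩ := word_spec (T := T) h₁ h₂
    have hxμ : x ∈ μ.cells := μ.isLowerSet hx h₃
    refine ⟨_, (entry_mem hxμ).1, ?_, word_entry hxμ⟩
    rw [← h₄]
    have h₅ : (x.1, (word T i).2) ∈ μ.cells :=
      μ.isLowerSet (a := word T i) (cell_le.2 ⟨hx.1, le_rfl⟩) h₃
    exact (T.row_weak_of_le hx.2 h₅).trans (T.col_weak hx.1 h₃)

/-- Entries at distance at most two never share a diagonal, so the tie-breaking in the reading order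
plays no role. -/
theorem leftOf_iff {i j : ℕ} (hi : 1 ≤ i) (hi' : i ≤ μ.card) (hj : 1 ≤ j) (hj' : j ≤ μ.card)
    (hij : i ≠ j) (h₁ : i ≤ j + 2) (h₂ : j ≤ i + 2) :
    T.LeftOf i j ↔ content (word T i) < content (word T j) := by
  have hne : content (word T i) ≠ content (word T j) := by
    rcases Nat.lt_or_gt_of_ne hij with h | h
    · exact isTableau_word.content_ne_of_le hi h hj' h₂
    · exact (isTableau_word.content_ne_of_le hj h hi' h₁).symm
  have key : ∀ x y : ℕ × ℕ, content x ≠ content y →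
      (readingKey x < readingKey y ↔ content x < content y) := by
    intro x y hxy
    unfold content at *
    rw [readingKey, readingKey, Prod.Lex.toLex_lt_toLex]
    exact ⟨fun h => h.resolve_right fun h => hxy h.1, Or.inl⟩
  rw [← key _ _ hne]
  constructor
  · rintro ⟨x, hx, y, hy, rfl, rfl, h⟩
    rwa [word_entry hx, word_entry hy]
  · intro h
    exact ⟨_, (word_spec hi hi').1, _, (word_spec hj hj').1, (word_spec hi hi').2,
      (word_spec hj hj').2, h⟩

theorem descentSign_eq_one_iff {i : ℕ} (hi : 1 ≤ i) (hi' : i + 1 ≤ μ.card) :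
    T.descentSign i = 1 ↔ Ascent (word T) i := by
  rw [Ascent, ← leftOf_iff hi (by omega) (by omega) hi' (by omega) (by omega) (by omega),
    StandardYoungTableau.descentSign]
  split_ifs with h
  · simp [h]
  · simp [h]

theorem between_iff {i a b c : ℕ} (hi : 1 ≤ i) (hi' : i + 2 ≤ μ.card) (ha : i ≤ a ∧ a ≤ i + 2)
    (hb : i ≤ b ∧ b ≤ i + 2) (hc : i ≤ c ∧ c ≤ i + 2) (hab : a ≠ b) (hbc : b ≠ c) :
    T.Between a b c ↔ Btw (content (word T a)) (content (word T b)) (content (word T c)) := by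
  unfold StandardYoungTableau.Between Btw
  rw [leftOf_iff, leftOf_iff, leftOf_iff, leftOf_iff] <;> omega

/-- Relabelling entries by `σ` composes the inverse filling with `σ⁻¹`, which is `σ`. Fixing `0`
keeps the default entry outside the diagram. -/
theorem entry_eq_iff {σ : ℕ → ℕ} (hσ : ∀ k, σ (σ k) = k)
    (hσ' : ∀ k, k = 0 ∨ μ.card < k → σ k = k) :
    (U.entry = fun r c => σ (T.entry r c)) ↔ word U = word T ∘ σ := by
  have hmem : ∀ k, 1 ≤ k → k ≤ μ.card → 1 ≤ σ k ∧ σ k ≤ μ.card := by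
    intro k h₁ h₂
    by_contra h₃
    have h₄ := hσ' (σ k) (by omega)
    rw [hσ] at h₄
    omega
  constructor
  · intro h
    funext k
    rw [Function.comp_apply]
    by_cases hk : 1 ≤ k ∧ k ≤ μ.card
    · obtain ⟨h₁, h₂⟩ := hmem k hk.1 hk.2
      obtain ⟨h₃, h₄⟩ := word_spec (T := T) h₁ h₂
      have h₅ := word_entry (T := U) h₃
      rw [h] at h₅
      dsimp only at h₅
      rwa [h₄, hσ] at h₅
    · rw [hσ' k (by omega), word_of_gt (by omega), word_of_gt (by omega)]
  · intro h
    funext r c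
    by_cases hx : (r, c) ∈ μ.cells
    · obtain ⟨h₁, h₂⟩ := entry_mem (T := U) hx
      obtain ⟨h₃, h₄⟩ := hmem _ h₁ h₂
      have h₅ := (word_spec (T := T) h₃ h₄).2
      have h₆ := word_entry (T := U) hx
      rw [h, Function.comp_apply] at h₆
      rw [h₆] at h₅
      dsimp only at h₅
      rw [h₅, hσ]
    · rw [entry_eq_zero (T := U) hx, entry_eq_zero (T := T) hx, hσ' 0 (Or.inl rfl)]

theorem word_injective (h : word T = word U) : T = U := by
  have h₁ : U.entry = fun r c => id (T.entry r c) :=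
    (entry_eq_iff (σ := id) (fun _ => rfl) (fun _ _ => rfl)).2 h.symm
  obtain ⟨⟨t, _, _, _⟩, _⟩ := T
  obtain ⟨⟨u, _, _, _⟩, _⟩ := U
  have h₂ : u = t := h₁
  subst h₂
  rfl

theorem entry_eq_elemDual_iff {i : ℕ} (hi : 1 ≤ i) (hi' : i + 2 ≤ μ.card) :
    U.entry = T.elemDual (i + 1) ↔ word U = dual i (word T) := by
  have hsw : ∀ j : ℕ, 1 ≤ j → j + 1 ≤ μ.card → ((U.entry = fun r c => Equiv.swap j (j + 1)
      (T.entry r c)) ↔ word U = word T ∘ Equiv.swap j (j + 1)) := fun j h₁ h₂ =>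
    entry_eq_iff (fun k => Equiv.swap_apply_self ..) fun k hk => swap_of_gt (by omega)
  have hid := entry_eq_iff (T := T) (U := U) (σ := id) (fun _ => rfl) (fun _ _ => rfl)
  unfold StandardYoungTableau.elemDual dual
  rw [Nat.add_sub_cancel, show i + 1 + 1 = i + 2 from rfl,
    between_iff hi hi' (by omega) (by omega) (by omega) (by omega) (by omega),
    between_iff hi hi' (by omega) (by omega) (by omega) (by omega) (by omega)]
  split_ifs
  · exact hid
  · exact hsw (i + 1) (by omega) hi'
  · rw [Equiv.swap_comm (i + 1) i]
    exact hsw i hi (by omega)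

/-- Every word of cells that lists the cells of a diagram so that all its initial segments are
diagrams comes from a standard tableau. -/
theorem exists_word_eq {t : ℕ → ℕ × ℕ} (ht : IsTableau μ.card t)
    (hs : shape t μ.card = μ.cells) (h₀ : ∀ k, k = 0 ∨ μ.card < k → t k = 0) :
    ∃ T : StandardYoungTableau μ, word T = t := by
  classical
  have hex : ∀ x, x ∈ μ.cells → ∃ k, 1 ≤ k ∧ k ≤ μ.card ∧ t k = x := fun x hx =>
    mem_shape.1 (hs.symm ▸ hx)
  have hmem : ∀ k, 1 ≤ k → k ≤ μ.card → t k ∈ μ.cells := fun k h₁ h₂ =>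
    hs ▸ mem_shape.2 ⟨k, h₁, h₂, rfl⟩
  set e : ℕ × ℕ → ℕ := fun x => if hx : x ∈ μ.cells then (hex x hx).choose else 0 with he
  have hespec : ∀ x, x ∈ μ.cells → 1 ≤ e x ∧ e x ≤ μ.card ∧ t (e x) = x := by
    intro x hx
    rw [he]
    dsimp only
    rw [dif_pos hx]
    exact (hex x hx).choose_spec
  have hte : ∀ k, 1 ≤ k → k ≤ μ.card → e (t k) = k := fun k h₁ h₂ => by
    obtain ⟨h₃, h₄, h₅⟩ := hespec (t k) (hmem k h₁ h₂)
    exact ht.inj _ _ h₃ h₄ h₁ h₂ h₅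
  have hle : ∀ x y, y ∈ μ.cells → x ≤ y → e x ≤ e y := by
    intro x y hy hxy
    obtain ⟨h₁, h₂, h₃⟩ := hespec y hy
    obtain ⟨h₄, h₅, h₆⟩ := hespec x (μ.isLowerSet hxy hy)
    exact ht.le_of_le h₄ h₅ h₁ h₂ (by rwa [h₆, h₃])
  let T : StandardYoungTableau μ :=
    { entry := fun r c => e (r, c)
      row_weak' := fun {i j1 j2} hj hc => hle _ _ hc (cell_le.2 ⟨le_rfl, hj.le⟩)
      col_strict' := fun {i1 i2 j} hi hc => by
        refine lt_of_le_of_ne (hle _ _ hc (cell_le.2 ⟨hi.le, le_rfl⟩)) fun h => ?_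
        have h₁ := (hespec _ (μ.up_left_mem hi.le le_rfl hc)).2.2
        rw [h, (hespec _ hc).2.2] at h₁
        exact hi.ne' (congrArg Prod.fst h₁)
      zeros' := fun {i j} hc => dif_neg hc
      bijOn := by
        refine ⟨fun x hx => ⟨(hespec x hx).1, (hespec x hx).2.1⟩, fun x hx y hy hxy => ?_,
          fun k hk => ⟨t k, hmem k hk.1 hk.2, hte k hk.1 hk.2⟩⟩
        have h₁ : e x = e y := hxy
        rw [← (hespec x hx).2.2, h₁, (hespec y hy).2.2] }
  refine ⟨T, funext fun k => ?_⟩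
  by_cases hk : 1 ≤ k ∧ k ≤ μ.card
  · obtain ⟨h₁, h₂⟩ := word_spec (T := T) hk.1 hk.2
    have h₃ : e (word T k) = k := h₂
    rw [← (hespec _ h₁).2.2, h₃]
  · rw [word_of_gt (by omega), h₀ k (by omega)]

theorem standardDEG_sign_eq_one_iff {n : ℕ} {p : n.Partition}
    {T : StandardYoungTableau p.toYoungDiagram} {i : ℕ} (hi : 1 ≤ i) (hi' : i < n) :
    (standardDEG p).sign T i = 1 ↔ Ascent (word T) i := by
  rw [SignedColoredGraph.sign, dif_pos ⟨hi, hi'⟩]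
  exact descentSign_eq_one_iff (i := i) hi (by rw [card_toYoungDiagram]; omega)

theorem standardDEG_adj_iff {n : ℕ} {p : n.Partition}
    {T U : StandardYoungTableau p.toYoungDiagram} {i : ℕ} (hi : 1 ≤ i) (hi' : i + 2 ≤ n) :
    ((standardDEG p).E (i + 1)).Adj T U ↔ T ≠ U ∧ word U = dual i (word T) := by
  have hc := card_toYoungDiagram p
  rw [SignedColoredGraph.E, dif_pos ⟨by omega, by omega⟩]
  change T ≠ U ∧ (U.entry = T.elemDual (i + 1) ∨ T.entry = U.elemDual (i + 1)) ↔ _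
  rw [entry_eq_elemDual_iff hi (by omega), entry_eq_elemDual_iff hi (by omega)]
  have key : word T = dual i (word U) → word U = dual i (word T) := fun h => by
    rw [h, isTableau_word.dual_dual hi (by omega)]
  tauto

end Word

end DualEquivalence

/-! ### The structure theorem -/

open DualEquivalence Relation

namespace SignedColoredGraph

variable {V : Type*} [Finite V] {n N : ℕ} (G : SignedColoredGraph V n N) {s : Set V}

theorem induce_adj (u v : s) (i : ℕ) : ((G.induce s).E i).Adj u v ↔ (G.E i).Adj u v := by
  unfold E
  split_ifs <;> rfl

end SignedColoredGraph

theorem mainTheorem1 {V : Type*} [Finite V] (n : ℕ) (G : SignedColoredGraph V n n)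
    (hG : G.IsDualEquivalenceGraph) (C : G.underlying.ConnectedComponent) :
    ∃! p : n.Partition, (G.induce C.supp).IsIsomorphic (standardDEG p) := by
  obtain ⟨Φ, hL, hI⟩ := exists_isLabelling hG le_rfl
  have hreach : ∀ u v : C.supp, (G.upTo (n - 1)).Reachable (u : V) v := fun u v =>
    SimpleGraph.ConnectedComponent.exact (u.2.trans v.2.symm)
  have hsupp : ∀ (u : C.supp) (v : V), (G.upTo (n - 1)).Reachable (u : V) v → v ∈ C.supp :=
    fun u v h => (SimpleGraph.ConnectedComponent.sound h).symm.trans u.2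
  obtain ⟨v₀, hv₀⟩ := C.nonempty_supp
  obtain ⟨p, hp⟩ := exists_toYoungDiagram_eq ⟨shape (Φ v₀) n, (hL.tab v₀).isLowerSet⟩
    (hL.tab v₀).card_shape
  have hcells : ∀ v : C.supp, shape (Φ v) n = p.toYoungDiagram.cells := fun v => by
    rw [hp]
    exact Step.shape_eq le_rfl (hL.steps_of_reachable le_rfl (hreach ⟨v₀, hv₀⟩ v))
  have hpc := card_toYoungDiagram p
  have hword : ∀ v : C.supp, ∃ T : StandardYoungTableau p.toYoungDiagram, word T = Φ v := fun v =>
    exists_word_eq (hpc.symm ▸ hL.tab v) (hpc.symm ▸ hcells v) (hpc.symm ▸ hL.zero v)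
  choose φ hφ using hword
  have hinj : Function.Injective φ := fun u v huv =>
    Subtype.ext (hI u v (hreach u v) (by rw [← hφ, ← hφ, huv]))
  refine ⟨p, ⟨φ, ⟨fun v i hi hi' => ?_, fun u v i hi hi' huv => ?_⟩, hinj, fun T => ?_⟩, ?_⟩
  · rw [units_eq_iff, standardDEG_sign_eq_one_iff hi hi', hφ]
    exact hL.sign v i hi hi'
  · obtain ⟨j, rfl⟩ : ∃ j, i = j + 1 := ⟨i - 1, by omega⟩
    rw [standardDEG_adj_iff (by omega) (by omega), hφ, hφ]
    exact ⟨hinj.ne huv.ne, hL.adj j u v (by omega) (by omega) ((G.induce_adj u v _).1 huv)⟩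
  -- Surjectivity: tableaux of one shape are connected by dual equivalences, and these lift to the
  -- component.
  · obtain ⟨u, hu, hΦ⟩ := hL.exists_reachable hG le_rfl le_rfl (v := v₀) (t := word T)
      (by have := isTableau_word (T := T); rwa [hpc] at this)
      (by rw [hcells ⟨v₀, hv₀⟩, ← shape_word (T := T), hpc])
      (fun k hk => by rw [hL.zero _ _ hk, word_of_gt (by omega)])
    exact ⟨⟨u, hsupp ⟨v₀, hv₀⟩ u hu⟩, word_injective (by rw [hφ, hΦ])⟩
  · rintro q ⟨ψ, ⟨hψs, hψa⟩, -⟩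
    have hqc := card_toYoungDiagram q
    have hsign : ∀ (v : C.supp) i, 1 ≤ i → i < n → (G.sign v i = 1 ↔ Ascent (word (ψ v)) i) := by
      intro v i hi hi'
      rw [← standardDEG_sign_eq_one_iff hi hi', ← hψs v i hi hi']
      rfl
    have htab : ∀ v : C.supp, IsTableau n (word (ψ v)) := fun v => by
      have := isTableau_word (T := ψ v)
      rwa [hqc] at this
    -- The labels `Φ v` and `word (ψ v)` have the same descents and move in parallel along edges, so
    -- they coincide, and so do their shapes.
    have key := eq_of_ascent_iff (m := n)
      (R := fun s t => ∃ v : C.supp, Φ v = s ∧ word (ψ v) = t) ?_ ?_ ?_ ⟨⟨v₀, hv₀⟩, rfl, rfl⟩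
    · refine toYoungDiagram_injective (YoungDiagram.ext ?_)
      rw [← hcells ⟨v₀, hv₀⟩, shape_congr key, ← shape_word (T := ψ ⟨v₀, hv₀⟩), hqc]
    · rintro _ _ i ⟨v, rfl, rfl⟩ hi hi'
      by_cases h : Ascent (Φ v) i ↔ Ascent (Φ v) (i + 1)
      · have h' := h
        rw [← hL.sign v i hi (by omega), ← hL.sign v (i + 1) (by omega) (by omega),
          hsign v i hi (by omega), hsign v (i + 1) (by omega) (by omega)] at h'
        exact ⟨v, (dual_of_btw ((hL.tab v).btw_of_ascent_iff hi hi' h)).symm,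
          (dual_of_btw ((htab v).btw_of_ascent_iff hi hi' h')).symm⟩
      · obtain ⟨x, hx⟩ := (hL.exists_adj_iff hG le_rfl hi hi' v).2 (by tauto)
        have hxC := hsupp v x (reachable_of_adj hx (by omega) (by omega))
        have hadj := hψa v ⟨x, hxC⟩ (i + 1) (by omega) (by omega) ((G.induce_adj _ _ _).2 hx)
        exact ⟨⟨x, hxC⟩, hL.adj i v x hi hi' hx, ((standardDEG_adj_iff hi hi').1 hadj).2⟩
    · rintro _ _ ⟨v, rfl, rfl⟩
      exact ⟨hL.tab v, htab v⟩
    · rintro _ _ i ⟨v, rfl, rfl⟩ hi hi'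
      rw [← hL.sign v i hi (by omega), hsign v i hi (by omega)]
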